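/- **Theorem.** Let $\mathbb K\in\{\mathbb R,\mathbb C\}$, let $(\Omega,\mathcal F,(\mathcal F_t)_{t\ge 0},\mathbb P)$ be a filtered probability space, $p\in(1,2]$ and $q\in[p,\infty)$. For a Banach space $X$ let $\mathcal M^p_{\rm loc}(X)$ be the space of all predictable $X$-valued processes $\xi$ with $\mathbb E\int_0^T\|\xi(s)\|_X^p\,ds<\infty$ for all $T>0$. Real interpolation spaces $(E_0,E_1)_{\theta,q}$ are those of the $K$-method, with $K(t,x)=\inf\{\|x_0\|_{E_0}+t\|x_1\|_{E_1}: x=x_0+x_1\}$ and $\|x\|_{(E_0,E_1)_{\theta,q}}^q=\int_0^\infty (t^{-\theta}K(t,x))^q\,\frac{dt}{t}$. Let $\mathcal E_p$ be a class of separable Banach spaces over $\mathbb K$. With each $E\in\mathcal E_p$ let there be associated a separable Banach space $R(E)$, on which bounded operators act: every bounded linear $\Phi:E_1\to E_2$ between spaces of the class defines a linear map $\xi\mapsto\Phi\xi$ from $R(E_1)$ to $R(E_2)$, linearly in $\Phi$, with $\mathrm{Id}\,\xi=\xi$ and $(\Psi\Phi)\xi=\Psi(\Phi\xi)$. For each $E\in\mathcal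 E_p$ let there also be linear operators $I_t:\mathcal M^p_{\rm loc}(R(E))\to L^p(\Omega,\mathcal F_t,\mathbb P;E)$, $t\ge0$, such that $\Phi I_t(\xi)=I_t(\Phi\xi)$ almost surely for all bounded $\Phi:E_1\to E_2$ between spaces of the class. Assume: * (R1) for each $E\in\mathcal E_p$ there is $C$ with $\mathbb E|I_t(\xi)|_E^p\le C\,\mathbb E\int_0^t\|\xi(r)\|_{R(E)}^p\,dr$ for all $t\ge0$ and $\xi\in\mathcal M^p_{\rm loc}(R(E))$; * (R2) if $E\in\mathcal E_p$ and $E_1$ is isomorphic to $E$, then $E_1\in\mathcal E_p$; * (R3) $\|\Phi\xi\|_{R(E_2)}\le\|\Phi\|\,\|\xi\|_{R(E_1)}$ for all $E_1,E_2\in\mathcal E_p$, bounded linear $\Phi:E_1\to E_2$ and $\xi\in R(E_1)$; * (R4) if $(E_0,E_1)$ is an interpolation couple with $E_0,E_1\in\mathcal E_p$, then $(E_0,E_1)_{\theta,q}\in\mathcal E_p$ for all $\theta\in(0,1)$. Let $E\in\mathcal E_p$ and let $-A$ be the generator of an analytic semigroup $(e^{-tA})_{t\ge0}$ on $E$ with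 $\|e^{-tA}\|\le C_0e^{\omega_0 t}$, $t\ge0$, for some constants $C_0$ and $\omega_0<0$. Write $D_A(\theta,q)=(E,D(A))_{\theta,q}$ (with the value $\infty$ for the norm of an $x\in E$ outside this space), and for $\xi\in R(E)$ let $\|\xi\|_{R(D_A(\theta,q))}$ be the infimum of the norms of those elements of $R(D_A(\theta,q))$ which the inclusion $D_A(\theta,q)\to E$ maps to $\xi$ ($\infty$ if there are none). Let $\theta\in(0,1-\frac1p)$ and assume moreover: * (R5) for every $\delta>0$ there is $K_\delta$ such that $\int_0^\delta\|r^{1-\theta}Ae^{-rA}\xi\|_{R(E)}^q\,\frac{dr}{r}\le K_\delta^q\,\|\xi\|_{R(D_A(\theta,q))}^q$ for all $\xi\in R(E)$; * (R6) there is $\hat C_q$ such that $\mathbb E|I_t(\xi)|_E^q\le\hat C_q\,\mathbb E\big(\int_0^t\|\xi(r)\|_{R(E)}^p\,dr\big)^{q/p}$ for all $t>0$ and $\xi\in\mathcal M^p_{\rm loc}(R(E))$. Put $SC_t(\xi)=I_t\big(1_{[0,t]}(\cdot)\,e^{-(t-\cdot)A}\xi(\cdot)\big)$. Then there is a constant $C$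 such that for all $T>0$ and all $\xi\in\mathcal M^p_{\rm loc}(R(E))$ $$\int_0^T\mathbb E\,|SC_t(\xi)|^q_{D_A(\theta+\frac1p,q)}\,dt\le C\,\mathbb E\int_0^T\|\xi(s)\|^q_{R(D_A(\theta,q))}\,ds,$$ and also, with the same $C$, $\mathbb E\int_0^T|Y_t|^q_{D_A(\theta+\frac1p,q)}\,dt\le C\,\mathbb E\int_0^T\|\xi(s)\|^q_{R(D_A(\theta,q))}\,ds$ for every jointly measurable version $Y$ of $t\mapsto SC_t(\xi)$. (If $t\mapsto\mathbb E\,|SC_t(\xi)|^q_{D_A(\theta+\frac1p,q)}$ is not measurable, the integral on the left of the displayed estimate is the lower one.) -/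

import Mathlib

open MeasureTheory Filter Topology Set
open scoped NNReal ENNReal

noncomputable section

namespace StochConv

universe k u v w

/-! ### Banach spaces and the real interpolation method -/

/-- A bundled Banach space over `𝕜` (`ℝ` or `ℂ`). -/
structure BanachSp (𝕜 : Type k) [RCLike 𝕜] : Type (max k (u + 1)) where
  carrier : Type u
  [normed : NormedAddCommGroup carrier]
  [space : NormedSpace 𝕜 carrier]
  [complete : CompleteSpace carrier]

instance {𝕜 : Type k} [RCLike 𝕜] : CoeSort (BanachSp.{k, u} 𝕜) (Type u) := ⟨BanachSp.carrier⟩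

attribute [instance] BanachSp.normed BanachSp.space BanachSp.complete

/-- The measure `dt / t` on `(0, ∞)`. -/
def dtt : Measure ℝ :=
  (volume.restrict (Ioi (0 : ℝ))).withDensity (fun t => ENNReal.ofReal t⁻¹)

section Interpolation

variable {𝕜 : Type k} [RCLike 𝕜] {X₀ X₁ : Type u}
  [NormedAddCommGroup X₀] [NormedSpace 𝕜 X₀] [NormedAddCommGroup X₁] [NormedSpace 𝕜 X₁]
  {Z : Type u} [AddCommGroup Z] [Module 𝕜 Z] [TopologicalSpace Z]

/-- Peetre's functional `K(t, z) = inf {‖x₀‖ + t ‖x₁‖ : z = x₀ + x₁}` of a couple embedded in `Z`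
(equal to `∞` if `z` is not in the sum of the two spaces). -/
def kFun (i₀ : X₀ →L[𝕜] Z) (i₁ : X₁ →L[𝕜] Z) (t : ℝ) (z : Z) : ℝ≥0∞ :=
  ⨅ (x : X₀ × X₁) (_ : i₀ x.1 + i₁ x.2 = z), (‖x.1‖ₑ + ENNReal.ofReal t * ‖x.2‖ₑ)

/-- The norm of the real interpolation space `(X₀, X₁)_{θ,q}`, with value `∞` outside this space:
`(∫₀^∞ (t^{-θ} K(t, z))^q dt/t)^{1/q}`. -/
def interpENorm (i₀ : X₀ →L[𝕜] Z) (i₁ : X₁ →L[𝕜] Z) (θ q : ℝ) (z : Z) : ℝ≥0∞ :=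
  (∫⁻ t, (ENNReal.ofReal (t ^ (-θ)) * kFun i₀ i₁ t z) ^ q ∂dtt) ^ (1 / q)

variable (i₀ : X₀ →L[𝕜] Z) (i₁ : X₁ →L[𝕜] Z)

lemma kFun_le {t : ℝ} {z : Z} (a : X₀) (b : X₁) (h : i₀ a + i₁ b = z) :
    kFun i₀ i₁ t z ≤ ‖a‖ₑ + ENNReal.ofReal t * ‖b‖ₑ :=
  iInf₂_le (a, b) h

lemma exists_decomp {t : ℝ} {z : Z} {c : ℝ≥0∞} (h : kFun i₀ i₁ t z < c) :
    ∃ (a : X₀) (b : X₁), i₀ a + i₁ b = z ∧ ‖a‖ₑ + ENNReal.ofReal t * ‖b‖ₑ < c := by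
  simp only [kFun, iInf_lt_iff] at h
  obtain ⟨x, hx, hc⟩ := h
  exact ⟨x.1, x.2, hx, hc⟩

lemma kFun_mono (z : Z) : Monotone (fun t => kFun i₀ i₁ t z) := by
  intro s t hst
  exact iInf₂_mono fun x _ => by gcongr

lemma kFun_zero (t : ℝ) : kFun i₀ i₁ t 0 = 0 :=
  le_antisymm ((kFun_le i₀ i₁ 0 0 (by simp)).trans (by simp)) zero_le

lemma kFun_smul (t : ℝ) (c : 𝕜) (z : Z) : kFun i₀ i₁ t (c • z) ≤ ‖c‖ₑ * kFun i₀ i₁ t z := by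
  by_cases hc : c = 0
  · simp [hc, kFun_zero]
  · rw [kFun, kFun]
    rw [ENNReal.mul_iInf_of_ne (by simpa using hc) (by simp)]
    refine le_iInf fun x => ?_
    rw [ENNReal.mul_iInf_of_ne (by simpa using hc) (by simp)]
    refine le_iInf fun hx => ?_
    refine (kFun_le i₀ i₁ (c • x.1) (c • x.2) (by simp [← hx])).trans ?_
    rw [enorm_smul, enorm_smul]
    apply le_of_eq
    ring

lemma kFun_add (t : ℝ) (y z : Z) :
    kFun i₀ i₁ t (y + z) ≤ kFun i₀ i₁ t y + kFun i₀ i₁ t z := by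
  refine ENNReal.le_of_forall_pos_le_add fun ε hε hfin => ?_
  have hy : kFun i₀ i₁ t y ≠ ∞ := (lt_of_le_of_lt le_self_add hfin).ne
  have hz : kFun i₀ i₁ t z ≠ ∞ := (lt_of_le_of_lt le_add_self hfin).ne
  have hε2 : ((ε / 2 : ℝ≥0) : ℝ≥0∞) ≠ 0 := by simpa using hε.ne'
  obtain ⟨a, b, hab, h1⟩ := exists_decomp i₀ i₁ (ENNReal.lt_add_right hy hε2)
  obtain ⟨a', b', hab', h2⟩ := exists_decomp i₀ i₁ (ENNReal.lt_add_right hz hε2)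
  refine (kFun_le i₀ i₁ (a + a') (b + b') (by rw [← hab, ← hab', map_add, map_add]; abel)).trans ?_
  calc ‖a + a'‖ₑ + ENNReal.ofReal t * ‖b + b'‖ₑ
      ≤ (‖a‖ₑ + ‖a'‖ₑ) + ENNReal.ofReal t * (‖b‖ₑ + ‖b'‖ₑ) := by
        gcongr <;> exact enorm_add_le _ _
    _ = (‖a‖ₑ + ENNReal.ofReal t * ‖b‖ₑ) + (‖a'‖ₑ + ENNReal.ofReal t * ‖b'‖ₑ) := by ring
    _ ≤ (kFun i₀ i₁ t y + (ε / 2 : ℝ≥0)) + (kFun i₀ i₁ t z + (ε / 2 : ℝ≥0)) := by gcongr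
    _ = kFun i₀ i₁ t y + kFun i₀ i₁ t z + ε := by
        have : (ε : ℝ≥0∞) = (ε / 2 : ℝ≥0) + (ε / 2 : ℝ≥0) := by
          rw [← ENNReal.coe_add, add_halves]
        rw [this]; ring

lemma measurable_weighted (θ : ℝ) (z : Z) :
    Measurable (fun t : ℝ => ENNReal.ofReal (t ^ (-θ)) * kFun i₀ i₁ t z) := by
  have := (kFun_mono i₀ i₁ z).measurable
  fun_prop

lemma interpENorm_zero (θ : ℝ) {q : ℝ} (hq : 1 ≤ q) : interpENorm i₀ i₁ θ q 0 = 0 := by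
  have : 0 < q := by linarith
  simp [interpENorm, kFun_zero, this]

lemma interpENorm_add (θ : ℝ) {q : ℝ} (hq : 1 ≤ q) (y z : Z) :
    interpENorm i₀ i₁ θ q (y + z) ≤ interpENorm i₀ i₁ θ q y + interpENorm i₀ i₁ θ q z := by
  have hq0 : 0 < q := by linarith
  refine le_trans ?_ (ENNReal.lintegral_Lp_add_le
    (measurable_weighted i₀ i₁ θ y).aemeasurable (measurable_weighted i₀ i₁ θ z).aemeasurable hq)
  simp only [interpENorm, Pi.add_apply]
  gcongr
  rw [← mul_add]
  gcongr
  exact kFun_add i₀ i₁ _ y z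

lemma interpENorm_smul (θ : ℝ) {q : ℝ} (hq : 1 ≤ q) (c : 𝕜) (z : Z) :
    interpENorm i₀ i₁ θ q (c • z) ≤ ‖c‖ₑ * interpENorm i₀ i₁ θ q z := by
  have hq0 : 0 < q := by linarith
  calc interpENorm i₀ i₁ θ q (c • z)
      ≤ (∫⁻ t, ‖c‖ₑ ^ q * (ENNReal.ofReal (t ^ (-θ)) * kFun i₀ i₁ t z) ^ q ∂dtt) ^ (1 / q) := by
        simp only [interpENorm]
        gcongr with t
        rw [← ENNReal.mul_rpow_of_nonneg _ _ hq0.le]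
        apply ENNReal.rpow_le_rpow _ hq0.le
        rw [mul_left_comm]
        gcongr
        exact kFun_smul i₀ i₁ t c z
    _ = ‖c‖ₑ * interpENorm i₀ i₁ θ q z := by
        rw [lintegral_const_mul _ ((measurable_weighted i₀ i₁ θ z).pow_const q),
          ENNReal.mul_rpow_of_nonneg _ _ (by positivity), ← ENNReal.rpow_mul,
          mul_one_div_cancel hq0.ne', ENNReal.rpow_one, interpENorm]

/-- `K(1, ·)` is dominated by the interpolation norm. -/
lemma kFun_one_le (θ : ℝ) {q : ℝ} (hq : 1 ≤ q) :
    ∃ c : ℝ≥0, ∀ z : Z, kFun i₀ i₁ 1 z ≤ c * interpENorm i₀ i₁ θ q z := by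
  have hq0 : 0 < q := by linarith
  set m : ℝ≥0∞ := ENNReal.ofReal (2 ^ (-|θ|)) with hm
  have hmpos : m ≠ 0 := by
    rw [hm]; simp only [ne_eq, ENNReal.ofReal_eq_zero, not_le]; positivity
  have hdtt : dtt (Icc 1 2) ≠ 0 := by
    have hsub : Icc (1 : ℝ) 2 ⊆ Ioi 0 := fun t ht => lt_of_lt_of_le one_pos ht.1
    have h1 : dtt (Icc 1 2) = ∫⁻ t in Icc (1 : ℝ) 2, ENNReal.ofReal t⁻¹ := by
      rw [dtt, withDensity_apply _ measurableSet_Icc, Measure.restrict_restrict measurableSet_Icc,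
        inter_eq_left.2 hsub]
    rw [h1]
    have h2 : ∫⁻ t in Icc (1 : ℝ) 2, ENNReal.ofReal (2⁻¹) ≤
        ∫⁻ t in Icc (1 : ℝ) 2, ENNReal.ofReal t⁻¹ := by
      refine setLIntegral_mono (by fun_prop) fun t ht => ?_
      apply ENNReal.ofReal_le_ofReal
      have : (0:ℝ) < t := lt_of_lt_of_le one_pos ht.1
      gcongr
      exact ht.2
    intro h0
    rw [h0] at h2
    simp at h2
  set d : ℝ≥0∞ := min (dtt (Icc 1 2)) 1 with hd
  have hd0 : d ≠ 0 := by simp [hd, hdtt]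
  have hdtop : d ≠ ∞ := (min_le_right _ _).trans_lt ENNReal.one_lt_top |>.ne
  have hdq0 : d ^ (1 / q) ≠ 0 := by
    simp [ENNReal.rpow_eq_zero_iff, hd0, hdtop]
  have hdqtop : d ^ (1 / q) ≠ ∞ := ENNReal.rpow_ne_top_of_nonneg (by positivity) hdtop
  have hmtop : m ≠ ∞ := ENNReal.ofReal_ne_top
  have hne0 : m * d ^ (1 / q) ≠ 0 := mul_ne_zero hmpos hdq0
  have hnetop : m * d ^ (1 / q) ≠ ∞ := ENNReal.mul_ne_top hmtop hdqtop
  refine ⟨((m * d ^ (1 / q))⁻¹).toNNReal, fun z => ?_⟩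
  rw [ENNReal.coe_toNNReal (ENNReal.inv_ne_top.2 hne0), mul_comm, ← div_eq_mul_inv,
    ENNReal.le_div_iff_mul_le (Or.inl hne0) (Or.inl hnetop)]
  have key : (m * kFun i₀ i₁ 1 z) ^ q * d ≤
      ∫⁻ t, (ENNReal.ofReal (t ^ (-θ)) * kFun i₀ i₁ t z) ^ q ∂dtt := by
    calc (m * kFun i₀ i₁ 1 z) ^ q * d
        ≤ (m * kFun i₀ i₁ 1 z) ^ q * dtt (Icc 1 2) := by gcongr; exact min_le_left _ _
      _ = ∫⁻ t in Icc 1 2, (m * kFun i₀ i₁ 1 z) ^ q ∂dtt := by simp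
      _ ≤ ∫⁻ t in Icc 1 2, (ENNReal.ofReal (t ^ (-θ)) * kFun i₀ i₁ t z) ^ q ∂dtt := by
          refine setLIntegral_mono ((measurable_weighted i₀ i₁ θ z).pow_const q) fun t ht => ?_
          gcongr
          · rw [hm]
            apply ENNReal.ofReal_le_ofReal
            have h1 : (1:ℝ) ≤ t := ht.1
            calc (2:ℝ) ^ (-|θ|) ≤ t ^ (-|θ|) :=
                  Real.rpow_le_rpow_of_nonpos (by linarith) ht.2 (by simp)
              _ ≤ t ^ (-θ) := Real.rpow_le_rpow_of_exponent_le h1 (neg_le_neg (le_abs_self θ))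
          · exact kFun_mono i₀ i₁ z ht.1
      _ ≤ _ := setLIntegral_le_lintegral _ _
  calc kFun i₀ i₁ 1 z * (m * d ^ (1 / q)) = ((m * kFun i₀ i₁ 1 z) ^ q * d) ^ (1 / q) := by
        rw [ENNReal.mul_rpow_of_nonneg _ _ (by positivity), ← ENNReal.rpow_mul,
          mul_one_div_cancel hq0.ne', ENNReal.rpow_one]
        ring
    _ ≤ _ := by rw [interpENorm]; gcongr

/-- The underlying linear space of `(X₀, X₁)_{θ,q}`. -/
def interpSubmodule (θ q : ℝ) (hq : 1 ≤ q) : Submodule 𝕜 Z where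
  carrier := {z | interpENorm i₀ i₁ θ q z < ∞}
  add_mem' := fun {y z} hy hz =>
    (interpENorm_add i₀ i₁ θ hq y z).trans_lt (ENNReal.add_lt_top.2 ⟨hy, hz⟩)
  zero_mem' := by simp [interpENorm_zero i₀ i₁ θ hq]
  smul_mem' := fun c z hz =>
    (interpENorm_smul i₀ i₁ θ hq c z).trans_lt (ENNReal.mul_lt_top (by simp) hz)

/-- The real interpolation space `(X₀, X₁)_{θ,q}` (it carries the interpolation norm,
not the topology of `Z`). -/
def Interp (θ q : ℝ) (hq : 1 ≤ q) : Type u := interpSubmodule i₀ i₁ θ q hq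

instance (θ q : ℝ) (hq : 1 ≤ q) : AddCommGroup (Interp i₀ i₁ θ q hq) :=
  inferInstanceAs (AddCommGroup (interpSubmodule i₀ i₁ θ q hq))

instance (θ q : ℝ) (hq : 1 ≤ q) : Module 𝕜 (Interp i₀ i₁ θ q hq) :=
  inferInstanceAs (Module 𝕜 (interpSubmodule i₀ i₁ θ q hq))

instance (θ q : ℝ) (hq : 1 ≤ q) : Norm (Interp i₀ i₁ θ q hq) :=
  ⟨fun z => (interpENorm i₀ i₁ θ q (z : interpSubmodule i₀ i₁ θ q hq).1).toReal⟩

/-- The canonical inclusion of the interpolation space in `Z`, as a linear map. -/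
def Interp.val (θ q : ℝ) (hq : 1 ≤ q) : Interp i₀ i₁ θ q hq →ₗ[𝕜] Z :=
  (interpSubmodule i₀ i₁ θ q hq).subtype

lemma Interp.norm_def {θ q : ℝ} {hq : 1 ≤ q} (z : Interp i₀ i₁ θ q hq) :
    ‖z‖ = (interpENorm i₀ i₁ θ q (Interp.val i₀ i₁ θ q hq z)).toReal := rfl

lemma Interp.lt_top {θ q : ℝ} {hq : 1 ≤ q} (z : Interp i₀ i₁ θ q hq) :
    interpENorm i₀ i₁ θ q (Interp.val i₀ i₁ θ q hq z) < ∞ := z.2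

lemma Interp.val_injective {θ q : ℝ} {hq : 1 ≤ q} :
    Function.Injective (Interp.val i₀ i₁ θ q hq) := Subtype.val_injective

lemma Interp.ofReal_norm {θ q : ℝ} {hq : 1 ≤ q} (z : Interp i₀ i₁ θ q hq) :
    ENNReal.ofReal ‖z‖ = interpENorm i₀ i₁ θ q (Interp.val i₀ i₁ θ q hq z) := by
  rw [Interp.norm_def, ENNReal.ofReal_toReal (Interp.lt_top i₀ i₁ z).ne]

variable [IsTopologicalAddGroup Z]

/-- Countable subadditivity of `K(t, ·)`, together with convergence. -/
lemma kFun_tsum [CompleteSpace X₀] [CompleteSpace X₁] {t : ℝ} (ht : 0 < t) (z : ℕ → Z)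
    (hz : ∑' n, kFun i₀ i₁ t (z n) ≠ ∞) {ε : ℝ≥0} (hε : 0 < ε) :
    ∃ x : Z, Tendsto (fun N => ∑ n ∈ Finset.range N, z n) atTop (𝓝 x) ∧
      kFun i₀ i₁ t x ≤ ∑' n, kFun i₀ i₁ t (z n) + ε := by
  obtain ⟨e, he, hes⟩ := ENNReal.exists_pos_sum_of_countable (ENNReal.coe_ne_zero.2 hε.ne') ℕ
  have hfin : ∀ n, kFun i₀ i₁ t (z n) ≠ ∞ := fun n => ENNReal.ne_top_of_tsum_ne_top hz n
  choose a b hab hlt using fun n =>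
    exists_decomp i₀ i₁ (ENNReal.lt_add_right (hfin n) (ENNReal.coe_ne_zero.2 (he n).ne'))
  have hsum : ∑' n, (‖a n‖ₑ + ENNReal.ofReal t * ‖b n‖ₑ) ≤ ∑' n, kFun i₀ i₁ t (z n) + ε := by
    calc _ ≤ ∑' n, (kFun i₀ i₁ t (z n) + e n) := ENNReal.tsum_le_tsum fun n => (hlt n).le
      _ = ∑' n, kFun i₀ i₁ t (z n) + ∑' n, (e n : ℝ≥0∞) := ENNReal.tsum_add
      _ ≤ _ := by gcongr
  have hsumtop : ∑' n, (‖a n‖ₑ + ENNReal.ofReal t * ‖b n‖ₑ) ≠ ∞ :=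
    (hsum.trans_lt (ENNReal.add_lt_top.2 ⟨hz.lt_top, ENNReal.coe_lt_top⟩)).ne
  rw [ENNReal.tsum_add, ENNReal.tsum_mul_left] at hsum hsumtop
  have hatop : ∑' n, ‖a n‖ₑ ≠ ∞ := fun h => hsumtop (by simp [h])
  have hbtop : ∑' n, ‖b n‖ₑ ≠ ∞ := fun h => hsumtop (by
    rw [h, ENNReal.mul_top (by simpa using ht)]; simp)
  have hsa : Summable fun n => ‖a n‖ := by
    have := ENNReal.summable_toReal hatop
    simpa using this
  have hsb : Summable fun n => ‖b n‖ := by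
    have := ENNReal.summable_toReal hbtop
    simpa using this
  refine ⟨i₀ (∑' n, a n) + i₁ (∑' n, b n), ?_, ?_⟩
  · have h0 := (i₀.continuous.tendsto _).comp hsa.of_norm.hasSum.tendsto_sum_nat
    have h1 := (i₁.continuous.tendsto _).comp hsb.of_norm.hasSum.tendsto_sum_nat
    refine (h0.add h1).congr fun N => ?_
    simp only [Function.comp_apply, map_sum, ← Finset.sum_add_distrib, hab]
  · refine (kFun_le i₀ i₁ _ _ rfl).trans (le_trans ?_ hsum)
    gcongr
    · exact enorm_tsum_le_tsum_enorm
    · exact enorm_tsum_le_tsum_enorm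

variable [T2Space Z]

lemma eq_zero_of_kFun {t : ℝ} (ht : 0 < t) {z : Z} (hz : kFun i₀ i₁ t z = 0) : z = 0 := by
  obtain ⟨e, -, he, hel⟩ := exists_seq_strictAnti_tendsto (0 : ℝ≥0)
  choose a b hab hlt using fun n => exists_decomp i₀ i₁ (t := t) (z := z) (c := e n)
    (by rw [hz]; exact_mod_cast he n)
  have he' : Tendsto (fun n => (e n : ℝ≥0∞)) atTop (𝓝 0) := by
    rw [← ENNReal.coe_zero]; exact ENNReal.tendsto_coe.2 hel
  have ha : Tendsto a atTop (𝓝 0) := by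
    rw [tendsto_zero_iff_enorm_tendsto_zero]
    exact tendsto_of_tendsto_of_tendsto_of_le_of_le tendsto_const_nhds he' (fun _ => zero_le)
      fun n => le_self_add.trans (hlt n).le
  have hb : Tendsto b atTop (𝓝 0) := by
    rw [tendsto_zero_iff_enorm_tendsto_zero]
    have h2 : Tendsto (fun n => (ENNReal.ofReal t)⁻¹ * (e n : ℝ≥0∞)) atTop (𝓝 0) := by
      have := ENNReal.Tendsto.const_mul (a := (ENNReal.ofReal t)⁻¹) he'
        (Or.inr (ENNReal.inv_ne_top.2 (by simpa using ht)))
      simpa using this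
    refine tendsto_of_tendsto_of_tendsto_of_le_of_le tendsto_const_nhds h2 (fun _ => zero_le)
      fun n => ?_
    have h3 : ENNReal.ofReal t * ‖b n‖ₑ ≤ e n := le_add_self.trans (hlt n).le
    change ‖b n‖ₑ ≤ _
    rw [mul_comm, ← div_eq_mul_inv, ENNReal.le_div_iff_mul_le (by simp [ht]) (by simp), mul_comm]
    exact h3
  have h0 := (i₀.continuous.tendsto _).comp ha
  have h1 := (i₁.continuous.tendsto _).comp hb
  have h := h0.add h1
  simp only [map_zero, add_zero] at h
  refine tendsto_nhds_unique (tendsto_const_nhds (x := z) (f := (atTop : Filter ℕ)))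
    (h.congr fun n => ?_)
  simp [hab]

lemma eq_zero_of_interpENorm (θ : ℝ) {q : ℝ} (hq : 1 ≤ q) {z : Z}
    (hz : interpENorm i₀ i₁ θ q z = 0) : z = 0 := by
  obtain ⟨c, hc⟩ := kFun_one_le i₀ i₁ θ hq
  refine eq_zero_of_kFun i₀ i₁ one_pos (le_antisymm ((hc z).trans ?_) zero_le)
  simp [hz]

lemma interp_core (θ q : ℝ) (hq : 1 ≤ q) : NormedSpace.Core 𝕜 (Interp i₀ i₁ θ q hq) where
  norm_nonneg := fun _ => ENNReal.toReal_nonneg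
  norm_smul := fun c z => by
    have hle : ∀ (c : 𝕜) (z : Interp i₀ i₁ θ q hq), ‖c • z‖ ≤ ‖c‖ * ‖z‖ := fun c z => by
      have := ENNReal.toReal_mono (ENNReal.mul_ne_top (by simp) (Interp.lt_top i₀ i₁ z).ne)
        (interpENorm_smul i₀ i₁ θ hq c (Interp.val i₀ i₁ θ q hq z))
      rw [ENNReal.toReal_mul, toReal_enorm] at this
      simpa only [Interp.norm_def, map_smul] using this
    refine le_antisymm (hle c z) ?_
    by_cases hc : c = 0
    · simp only [hc, norm_zero, zero_mul]; exact ENNReal.toReal_nonneg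
    · have h := hle c⁻¹ (c • z)
      rw [smul_smul, inv_mul_cancel₀ hc, one_smul, norm_inv] at h
      have hpos : 0 < ‖c‖ := norm_pos_iff.2 hc
      calc ‖c‖ * ‖z‖ ≤ ‖c‖ * (‖c‖⁻¹ * ‖c • z‖) := by gcongr
        _ = ‖c • z‖ := by field_simp
  norm_triangle := fun y z => by
    have h := ENNReal.toReal_mono
      (ENNReal.add_ne_top.2 ⟨(Interp.lt_top i₀ i₁ y).ne, (Interp.lt_top i₀ i₁ z).ne⟩)
      (interpENorm_add i₀ i₁ θ hq (Interp.val i₀ i₁ θ q hq y) (Interp.val i₀ i₁ θ q hq z))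
    rw [ENNReal.toReal_add (Interp.lt_top i₀ i₁ y).ne (Interp.lt_top i₀ i₁ z).ne] at h
    simpa only [Interp.norm_def, map_add] using h
  norm_eq_zero_iff := fun z => by
    constructor
    · intro h
      rw [Interp.norm_def, ENNReal.toReal_eq_zero_iff] at h
      rcases h with h | h
      · apply Interp.val_injective i₀ i₁
        rw [map_zero]
        exact eq_zero_of_interpENorm i₀ i₁ θ hq h
      · exact absurd h (Interp.lt_top i₀ i₁ z).ne
    · rintro rfl
      simp [Interp.norm_def, interpENorm_zero i₀ i₁ θ hq]

instance (θ q : ℝ) (hq : 1 ≤ q) : NormedAddCommGroup (Interp i₀ i₁ θ q hq) :=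
  NormedAddCommGroup.ofCore (interp_core i₀ i₁ θ q hq)

instance (θ q : ℝ) (hq : 1 ≤ q) : NormedSpace 𝕜 (Interp i₀ i₁ θ q hq) :=
  NormedSpace.ofCore (interp_core i₀ i₁ θ q hq)

/-- Countable subadditivity of the interpolation norm. -/
lemma interpENorm_tsum [CompleteSpace X₀] [CompleteSpace X₁] (θ : ℝ) {q : ℝ} (hq : 1 ≤ q)
    (z : ℕ → Z) (x : Z) (hx : Tendsto (fun N => ∑ n ∈ Finset.range N, z n) atTop (𝓝 x)) :
    interpENorm i₀ i₁ θ q x ≤ ∑' n, interpENorm i₀ i₁ θ q (z n) := by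
  have hq0 : 0 < q := by linarith
  set f : ℕ → ℝ → ℝ≥0∞ := fun n t => ENNReal.ofReal (t ^ (-θ)) * kFun i₀ i₁ t (z n) with hf
  have hfm : ∀ n, Measurable (f n) := fun n => measurable_weighted i₀ i₁ θ (z n)
  have hpt : ∀ t ∈ Ioi (0 : ℝ), kFun i₀ i₁ t x ≤ ∑' n, kFun i₀ i₁ t (z n) := by
    intro t ht
    refine ENNReal.le_of_forall_pos_le_add fun ε hε hfin => ?_
    obtain ⟨x', hx', hle⟩ := kFun_tsum i₀ i₁ ht z hfin.ne hε
    rwa [tendsto_nhds_unique hx hx']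
  have hfinite : ∀ N, (∫⁻ t, (∑ n ∈ Finset.range N, f n t) ^ q ∂dtt) ^ (1 / q) ≤
      ∑ n ∈ Finset.range N, interpENorm i₀ i₁ θ q (z n) := by
    intro N
    induction N with
    | zero => simp [hq0]
    | succ N ih =>
      simp only [Finset.sum_range_succ]
      refine (ENNReal.lintegral_Lp_add_le (μ := dtt)
        (f := fun t => ∑ n ∈ Finset.range N, f n t) (g := f N)
        (Finset.measurable_sum _ fun n _ => hfm n).aemeasurable (hfm N).aemeasurable hq).trans ?_
      gcongr
      exact le_of_eq rfl
  have hae : ∀ᵐ t ∂dtt, (ENNReal.ofReal (t ^ (-θ)) * kFun i₀ i₁ t x) ^ q ≤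
      (∑' n, f n t) ^ q := by
    have h0 : ∀ᵐ t ∂(volume.restrict (Ioi (0 : ℝ))), t ∈ Ioi (0 : ℝ) :=
      ae_restrict_mem measurableSet_Ioi
    have h1 : ∀ᵐ t ∂dtt, t ∈ Ioi (0 : ℝ) := (withDensity_absolutelyContinuous _ _).ae_le h0
    filter_upwards [h1] with t ht
    gcongr
    rw [hf, ENNReal.tsum_mul_left]
    gcongr
    exact hpt t ht
  have hmct : ∫⁻ t, (∑' n, f n t) ^ q ∂dtt =
      ⨆ N, ∫⁻ t, (∑ n ∈ Finset.range N, f n t) ^ q ∂dtt := by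
    rw [← lintegral_iSup]
    · congr 1 with t
      rw [ENNReal.tsum_eq_iSup_nat]
      exact (ENNReal.orderIsoRpow q hq0).map_iSup _
    · exact fun N => (Finset.measurable_sum _ fun n _ => hfm n).pow_const q
    · intro M N hMN t
      dsimp only
      gcongr
  have hbound : ∫⁻ t, (∑' n, f n t) ^ q ∂dtt ≤ (∑' n, interpENorm i₀ i₁ θ q (z n)) ^ q := by
    rw [hmct]
    refine iSup_le fun N => ?_
    rw [← ENNReal.rpow_le_rpow_iff (z := 1 / q) (by positivity), ← ENNReal.rpow_mul,
      mul_one_div_cancel hq0.ne', ENNReal.rpow_one]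
    exact (hfinite N).trans (ENNReal.sum_le_tsum _)
  calc interpENorm i₀ i₁ θ q x ≤ (∫⁻ t, (∑' n, f n t) ^ q ∂dtt) ^ (1 / q) := by
        rw [interpENorm]
        gcongr ?_ ^ _
        exact lintegral_mono_ae hae
    _ ≤ ((∑' n, interpENorm i₀ i₁ θ q (z n)) ^ q) ^ (1 / q) := by gcongr
    _ = _ := by rw [← ENNReal.rpow_mul, mul_one_div_cancel hq0.ne', ENNReal.rpow_one]

instance [CompleteSpace X₀] [CompleteSpace X₁] (θ q : ℝ) (hq : 1 ≤ q) :
    CompleteSpace (Interp i₀ i₁ θ q hq) := by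
  refine NormedAddCommGroup.completeSpace_of_summable_imp_tendsto fun y hy => ?_
  set V := Interp.val i₀ i₁ θ q hq with hV
  have hsum : ∑' n, interpENorm i₀ i₁ θ q (V (y n)) ≠ ∞ := by
    have h := hy.tsum_ofReal_ne_top
    simpa only [Interp.ofReal_norm] using h
  obtain ⟨c, hc⟩ := kFun_one_le i₀ i₁ θ hq
  have hK : ∑' n, kFun i₀ i₁ 1 (V (y n)) ≠ ∞ := by
    refine ((ENNReal.tsum_le_tsum fun n => hc (V (y n))).trans_lt ?_).ne
    rw [ENNReal.tsum_mul_left]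
    exact ENNReal.mul_lt_top ENNReal.coe_lt_top hsum.lt_top
  obtain ⟨x, hx, -⟩ := kFun_tsum i₀ i₁ one_pos (fun n => V (y n)) hK one_pos
  have hxfin : interpENorm i₀ i₁ θ q x < ∞ :=
    (interpENorm_tsum i₀ i₁ θ hq _ x hx).trans_lt hsum.lt_top
  set x' : Interp i₀ i₁ θ q hq := (⟨x, hxfin⟩ : interpSubmodule i₀ i₁ θ q hq) with hx'
  have hVx : V x' = x := rfl
  refine ⟨x', ?_⟩
  rw [tendsto_iff_norm_sub_tendsto_zero]
  have htail : ∀ N, interpENorm i₀ i₁ θ q (x - ∑ n ∈ Finset.range N, V (y n)) ≤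
      ∑' n, interpENorm i₀ i₁ θ q (V (y (n + N))) := by
    intro N
    refine interpENorm_tsum i₀ i₁ θ hq _ _ ?_
    have h1 := (hx.comp (tendsto_add_atTop_nat N)).sub
      (tendsto_const_nhds (x := ∑ n ∈ Finset.range N, V (y n)))
    refine h1.congr fun M => ?_
    simp only [Function.comp_apply]
    rw [add_comm M N, Finset.sum_range_add, add_sub_cancel_left]
    simp only [add_comm N]
  have hlim := ENNReal.tendsto_sum_nat_add (fun n => interpENorm i₀ i₁ θ q (V (y n))) hsum
  have hlim2 := (ENNReal.tendsto_toReal ENNReal.zero_ne_top).comp hlim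
  simp only [ENNReal.toReal_zero] at hlim2
  refine squeeze_zero (fun _ => norm_nonneg _) (fun N => ?_) hlim2
  rw [norm_sub_rev, Interp.norm_def, map_sub, map_sum]
  refine ENNReal.toReal_mono ?_ (htail N)
  refine ((ENNReal.tsum_comp_le_tsum_of_injective (add_left_injective N) _).trans_lt
    hsum.lt_top).ne

/-- The Banach space `(X₀, X₁)_{θ,q}`. -/
def interpSp (X₀ X₁ : BanachSp.{k, u} 𝕜) (i₀ : X₀ →L[𝕜] Z) (i₁ : X₁ →L[𝕜] Z)
    (θ q : ℝ) (hq : 1 ≤ q) : BanachSp.{k, u} 𝕜 := ⟨Interp i₀ i₁ θ q hq⟩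

/-- The inclusion of `(X₀, X₁)_{θ,q}` in the ambient space (here a normed one). -/
def interpIncl {X₀ X₁ : BanachSp.{k, u} 𝕜} {Z : Type u} [NormedAddCommGroup Z] [NormedSpace 𝕜 Z]
    (i₀ : X₀ →L[𝕜] Z) (i₁ : X₁ →L[𝕜] Z) (θ q : ℝ) (hq : 1 ≤ q) :
    interpSp X₀ X₁ i₀ i₁ θ q hq →L[𝕜] Z where
  toLinearMap := Interp.val i₀ i₁ θ q hq
  cont := by
    obtain ⟨c, hc⟩ := kFun_one_le i₀ i₁ θ hq
    set b : ℝ≥0 := max ‖i₀‖₊ ‖i₁‖₊ + 1 with hb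
    have h1 : ∀ z : Z, ‖z‖ₑ ≤ b * kFun i₀ i₁ 1 z := by
      intro z
      have hb0 : (b : ℝ≥0∞) ≠ 0 := by simp [hb]
      rw [mul_comm, ← ENNReal.div_le_iff_le_mul (Or.inl hb0) (Or.inl ENNReal.coe_ne_top)]
      refine le_iInf₂ fun x hx => ?_
      rw [ENNReal.div_le_iff_le_mul (Or.inl hb0) (Or.inl ENNReal.coe_ne_top), ← hx,
        ENNReal.ofReal_one, one_mul, add_mul]
      have e0 : ‖i₀‖ₑ ≤ b := by
        rw [enorm_eq_nnnorm]; exact_mod_cast (le_max_left _ _).trans le_self_add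
      have e1 : ‖i₁‖ₑ ≤ b := by
        rw [enorm_eq_nnnorm]; exact_mod_cast (le_max_right _ _).trans le_self_add
      refine (enorm_add_le _ _).trans (add_le_add ?_ ?_)
      · exact (i₀.le_opENorm _).trans (by rw [mul_comm]; gcongr)
      · exact (i₁.le_opENorm _).trans (by rw [mul_comm]; gcongr)
    refine AddMonoidHomClass.continuous_of_bound (Interp.val i₀ i₁ θ q hq) (b * c) fun z => ?_
    have h2 := (h1 (Interp.val i₀ i₁ θ q hq z)).trans
      (mul_le_mul_right (hc (Interp.val i₀ i₁ θ q hq z)) (b : ℝ≥0∞))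
    rw [← Interp.ofReal_norm, ← ofReal_norm, ← ENNReal.ofReal_coe_nnreal,
      ← ENNReal.ofReal_coe_nnreal, ← ENNReal.ofReal_mul (by positivity),
      ← ENNReal.ofReal_mul (by positivity)] at h2
    rw [mul_assoc]
    exact (ENNReal.ofReal_le_ofReal_iff (by positivity)).1 h2

end Interpolation

/-! ### Semigroups, generators, analyticity -/

section Semigroup

variable {𝕜 : Type k} [RCLike 𝕜] {E : Type u} [NormedAddCommGroup E] [NormedSpace 𝕜 E]

/-- A strongly continuous semigroup `(S t)_{t ≥ 0}` of bounded operators (the values at negative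
times are irrelevant). -/
structure C0Semigroup (𝕜 : Type k) [RCLike 𝕜] (E : Type u) [NormedAddCommGroup E]
    [NormedSpace 𝕜 E] where
  toFun : ℝ → E →L[𝕜] E
  map_zero : toFun 0 = ContinuousLinearMap.id 𝕜 E
  map_add : ∀ s t : ℝ, 0 ≤ s → 0 ≤ t → toFun (s + t) = (toFun s).comp (toFun t)
  strongly_cont : ∀ x : E, Tendsto (fun t => toFun t x) (𝓝[>] 0) (𝓝 x)

instance : CoeFun (C0Semigroup 𝕜 E) (fun _ => ℝ → E →L[𝕜] E) := ⟨C0Semigroup.toFun⟩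

/-- The operator `A` such that `-A` is the infinitesimal generator of the semigroup `S = e^{-·A}`:
`A x = lim_{h ↓ 0} (x - S h x) / h`, on the domain of all `x` for which the limit exists. -/
def C0Semigroup.opA (S : C0Semigroup 𝕜 E) : E →ₗ.[𝕜] E where
  domain :=
    { carrier := {x | ∃ y, Tendsto (fun h : ℝ => ((h : 𝕜))⁻¹ • (x - S h x)) (𝓝[>] 0) (𝓝 y)}
      add_mem' := by
        rintro x x' ⟨y, hy⟩ ⟨y', hy'⟩
        refine ⟨y + y', (hy.add hy').congr fun h => ?_⟩
        rw [← smul_add, _root_.map_add]; congr 1; abel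
      zero_mem' := ⟨0, by simp⟩
      smul_mem' := by
        rintro c x ⟨y, hy⟩
        refine ⟨c • y, (hy.const_smul c).congr fun h => ?_⟩
        rw [map_smul, ← smul_sub, smul_comm] }
  toFun :=
    { toFun := fun x => x.2.choose
      map_add' := fun x x' => by
        refine tendsto_nhds_unique (x + x').2.choose_spec
          ((x.2.choose_spec.add x'.2.choose_spec).congr fun h => ?_)
        rw [← smul_add, Submodule.coe_add, _root_.map_add]; congr 1; abel
      map_smul' := fun c x => by
        refine tendsto_nhds_unique (c • x).2.choose_spec
          ((x.2.choose_spec.const_smul c).congr fun h => ?_)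
        rw [Submodule.coe_smul, map_smul, ← smul_sub, smul_comm] }

lemma C0Semigroup.mem_graph_iff (S : C0Semigroup 𝕜 E) (x y : E) :
    (x, y) ∈ S.opA.graph ↔
      Tendsto (fun h : ℝ => ((h : 𝕜))⁻¹ • (x - S h x)) (𝓝[>] 0) (𝓝 y) := by
  rw [LinearPMap.mem_graph_iff]
  constructor
  · rintro ⟨z, hz, hy⟩
    have h := z.2.choose_spec
    have hy' : z.2.choose = y := hy
    rw [hy'] at h
    have hz' : (z : E) = x := hz
    rwa [hz'] at h
  · intro h
    exact ⟨⟨x, y, h⟩, rfl, tendsto_nhds_unique (Subtype.prop (⟨x, y, h⟩ : S.opA.domain)).choose_spec h⟩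

lemma C0Semigroup.tendsto_ge (S : C0Semigroup 𝕜 E) (x : E) :
    Tendsto (fun s => S s x) (𝓝[≥] 0) (𝓝 x) := by
  rw [← Ioi_insert, nhdsWithin_insert, tendsto_sup]
  refine ⟨?_, S.strongly_cont x⟩
  have : S 0 x = x := by simp [S.map_zero]
  rw [tendsto_pure_left]
  intro s hs
  rw [this]
  exact mem_of_mem_nhds hs

/-- Uniform boundedness on compact time intervals. -/
lemma C0Semigroup.exists_bound [CompleteSpace E] (S : C0Semigroup 𝕜 E) (T : ℝ) :
    ∃ M : ℝ, 1 ≤ M ∧ ∀ t ∈ Icc 0 T, ‖S t‖ ≤ M := by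
  -- first a bound near zero
  obtain ⟨τ, hτ, M, hM⟩ : ∃ τ > 0, ∃ M : ℝ, ∀ t ∈ Icc 0 τ, ‖S t‖ ≤ M := by
    by_contra! hcon
    have hn : ∀ n : ℕ, ∃ t ∈ Icc (0 : ℝ) (1 / ((n : ℝ) + 1)), (n : ℝ) < ‖S t‖ := fun n =>
      hcon _ (by positivity) _
    choose t ht hlt using hn
    have htlim : Tendsto t atTop (𝓝 0) :=
      squeeze_zero (fun n => (ht n).1) (fun n => (ht n).2) tendsto_one_div_add_atTop_nhds_zero_nat
    have hbdd : ∀ x : E, ∃ C, ∀ n, ‖S (t n) x‖ ≤ C := by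
      intro x
      have h1 : Tendsto (fun n => S (t n) x) atTop (𝓝 x) :=
        (S.tendsto_ge x).comp (tendsto_nhdsWithin_iff.2 ⟨htlim, Eventually.of_forall fun n => (ht n).1⟩)
      obtain ⟨C, hC⟩ := h1.norm.bddAbove_range
      exact ⟨C, fun n => hC ⟨n, rfl⟩⟩
    obtain ⟨C, hC⟩ := banach_steinhaus hbdd
    obtain ⟨n, hn⟩ := exists_nat_gt C
    exact absurd (hC n) (not_le.2 (hn.trans (hlt n)))
  -- propagate it by the semigroup law
  have hM1 : (1 : ℝ) ≤ max M 1 := le_max_right _ _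
  have hstep : ∀ n : ℕ, ∀ t ∈ Icc 0 (n * τ), ‖S t‖ ≤ (max M 1) ^ (n + 1) := by
    intro n
    induction n with
    | zero =>
      intro t ht
      simp only [Nat.cast_zero, zero_mul] at ht
      have := hM t ⟨ht.1, ht.2.trans hτ.le⟩
      simpa using Or.inl this
    | succ n ih =>
      intro t ht
      rcases le_total t τ with h | h
      · calc ‖S t‖ ≤ max M 1 := (hM t ⟨ht.1, h⟩).trans (le_max_left _ _)
          _ = (max M 1) ^ 1 := (pow_one _).symm
          _ ≤ _ := pow_le_pow_right₀ hM1 (by omega)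
      · have h2 : t - τ ∈ Icc 0 ((n : ℝ) * τ) := by
          refine ⟨by linarith, ?_⟩
          have := ht.2
          push_cast at this
          linarith
        have h3 : S t = (S (t - τ)).comp (S τ) := by
          rw [← S.map_add _ _ h2.1 hτ.le, sub_add_cancel]
        calc ‖S t‖ ≤ ‖S (t - τ)‖ * ‖S τ‖ := by
              rw [h3]; exact ContinuousLinearMap.opNorm_comp_le _ _
          _ ≤ (max M 1) ^ (n + 1) * max M 1 := by
              gcongr
              · exact ih _ h2
              · exact (hM τ ⟨hτ.le, le_rfl⟩).trans (le_max_left _ _)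
          _ = _ := (pow_succ _ _).symm
  obtain ⟨n, hn⟩ := exists_nat_gt (T / τ)
  refine ⟨(max M 1) ^ (n + 1), one_le_pow₀ hM1, fun t ht => hstep n t ⟨ht.1, ht.2.trans ?_⟩⟩
  rw [div_lt_iff₀ hτ] at hn
  exact hn.le

lemma C0Semigroup.continuousOn [CompleteSpace E] (S : C0Semigroup 𝕜 E) (x : E) :
    ContinuousOn (fun s => S s x) (Ici 0) := by
  intro s hs
  have hs0 : (0 : ℝ) ≤ s := hs
  obtain ⟨M, hM1, hM⟩ := S.exists_bound (s + 1)
  have h1 : Tendsto (fun r => M * ‖S |r - s| x - x‖) (𝓝[Ici 0] s) (𝓝 (M * 0)) := by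
    refine Tendsto.const_mul _ ?_
    have h2 : Tendsto (fun r : ℝ => |r - s|) (𝓝[Ici 0] s) (𝓝[≥] 0) := by
      refine tendsto_nhdsWithin_iff.2 ⟨?_, Eventually.of_forall fun r => abs_nonneg (r - s)⟩
      have : Tendsto (fun r : ℝ => |r - s|) (𝓝 s) (𝓝 (|s - s|)) := by
        exact Continuous.tendsto (by fun_prop) s
      simp only [sub_self, abs_zero] at this
      exact this.mono_left nhdsWithin_le_nhds
    have h3 := ((S.tendsto_ge x).comp h2).sub_const x
    simpa using h3.norm
  rw [mul_zero] at h1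
  rw [ContinuousWithinAt, tendsto_iff_norm_sub_tendsto_zero]
  refine squeeze_zero' (Eventually.of_forall fun _ => norm_nonneg _) ?_ h1
  have hev : ∀ᶠ r in 𝓝[Ici 0] s, r < s + 1 :=
    nhdsWithin_le_nhds (Iio_mem_nhds (by linarith))
  filter_upwards [hev, self_mem_nhdsWithin] with r hr1 hr0
  have hr0' : (0 : ℝ) ≤ r := hr0
  have haux : ∀ a b : ℝ, 0 ≤ a → a ≤ b → a ≤ s + 1 → ‖S b x - S a x‖ ≤ M * ‖S (b - a) x - x‖ := by
    intro a b ha hab has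
    have h3 : S b x = S a (S (b - a) x) := by
      rw [← ContinuousLinearMap.comp_apply, ← S.map_add _ _ ha (by linarith)]
      congr 2; ring
    rw [h3, ← map_sub]
    exact ((S a).le_opNorm _).trans (by gcongr; exact hM a ⟨ha, has⟩)
  rcases le_total s r with h | h
  · rw [abs_of_nonneg (by linarith)]
    exact haux s r hs0 h (by linarith)
  · rw [abs_of_nonpos (by linarith), norm_sub_rev, neg_sub]
    exact haux r s hr0' h hr1.le

/-- Generators are closed operators. -/
lemma C0Semigroup.isClosed_graph [CompleteSpace E] (S : C0Semigroup 𝕜 E) :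
    IsClosed (S.opA.graph : Set (E × E)) := by
  let _ : NormedSpace ℝ E := NormedSpace.restrictScalars ℝ 𝕜 E
  have hsm : ∀ (h : ℝ) (x : E), (((h : 𝕜))⁻¹) • x = h⁻¹ • x := fun h x => by
    rw [← RCLike.ofReal_inv]; rfl
  obtain ⟨M, hM1, hM⟩ := S.exists_bound 1
  -- the mean value inequality for elements of the domain
  have hmv : ∀ x y : E, (x, y) ∈ S.opA.graph → ∀ τ ∈ Icc (0 : ℝ) 1, ∀ C : ℝ,
      (∀ s ∈ Icc 0 τ, ‖S s y - y‖ ≤ C) → ‖x - S τ x - τ • y‖ ≤ C * τ := by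
    intro x y hxy τ hτ C hC
    rw [S.mem_graph_iff] at hxy
    have hcont : ContinuousOn (fun s : ℝ => x - S s x - s • y) (Icc 0 τ) := by
      have := (S.continuousOn x).mono (fun s hs => hs.1 : Icc 0 τ ⊆ Ici 0)
      fun_prop
    have hder : ∀ s ∈ Ico 0 τ, HasDerivWithinAt (fun s : ℝ => x - S s x - s • y)
        (S s y - y) (Ici s) s := by
      intro s hs
      have h1 : HasDerivWithinAt (fun s : ℝ => x - S s x) (S s y) (Ici s) s := by
        rw [hasDerivWithinAt_iff_tendsto_slope, Ici_sdiff_left]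
        have h2 : Tendsto (fun r : ℝ => r - s) (𝓝[>] s) (𝓝[>] 0) := by
          refine tendsto_nhdsWithin_iff.2 ⟨?_, ?_⟩
          · have : Tendsto (fun r : ℝ => r - s) (𝓝 s) (𝓝 (s - s)) :=
              Continuous.tendsto (by fun_prop) s
            rw [sub_self] at this
            exact this.mono_left nhdsWithin_le_nhds
          · filter_upwards [self_mem_nhdsWithin] with r hr
            exact sub_pos_of_lt (α := ℝ) hr
        have h3 := ((S s).continuous.tendsto _).comp (hxy.comp h2)
        refine h3.congr' ?_
        filter_upwards [self_mem_nhdsWithin] with r hr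
        have hr' : s < r := hr
        have h4 : S r x = S s (S (r - s) x) := by
          rw [← ContinuousLinearMap.comp_apply, ← S.map_add _ _ hs.1 (by linarith)]
          congr 2; ring
        simp only [Function.comp_apply, slope_def_module]
        rw [h4, map_smul, map_sub, hsm]
        congr 1
        abel
      have h5 : HasDerivWithinAt (fun s : ℝ => s • y) y (Ici s) s := by
        simpa using (hasDerivWithinAt_id s (Ici s)).smul_const y
      exact h1.sub h5
    have := norm_image_sub_le_of_norm_deriv_right_le_segment hcont hder
      (fun s hs => hC s ⟨hs.1, hs.2.le⟩) τ ⟨hτ.1, le_rfl⟩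
    simpa [S.map_zero] using this
  rw [← isSeqClosed_iff_isClosed]
  rintro u ⟨x, y⟩ hu hlim
  have hx : Tendsto (fun n => (u n).1) atTop (𝓝 x) := (continuous_fst.tendsto _).comp hlim
  have hy : Tendsto (fun n => (u n).2) atTop (𝓝 y) := (continuous_snd.tendsto _).comp hlim
  change (x, y) ∈ S.opA.graph
  rw [S.mem_graph_iff, Metric.tendsto_nhdsWithin_nhds]
  intro ε hε
  obtain ⟨τ, hτ, hτε⟩ := Metric.tendsto_nhdsWithin_nhds.1 (S.tendsto_ge y) (ε / 2) (by linarith)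
  refine ⟨min τ 1, lt_min hτ one_pos, fun {t} ht0 htd => ?_⟩
  have ht0' : (0 : ℝ) < t := ht0
  rw [Real.dist_eq, sub_zero, abs_of_pos ht0'] at htd
  have htτ : t < τ := htd.trans_le (min_le_left _ _)
  have ht1 : t < 1 := htd.trans_le (min_le_right _ _)
  have hbd : ∀ n, ‖(u n).1 - S t (u n).1 - t • (u n).2‖ ≤
      (ε / 2 + (M + 1) * ‖(u n).2 - y‖) * t := by
    intro n
    refine hmv _ _ (hu n) t ⟨ht0'.le, ht1.le⟩ _ fun s hs => ?_
    have h1 : ‖S s y - y‖ ≤ ε / 2 := by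
      have := hτε (x := s) hs.1 (by
        rw [Real.dist_eq, sub_zero, abs_of_nonneg hs.1]; exact hs.2.trans_lt htτ)
      rw [dist_eq_norm] at this
      exact this.le
    have h2 : S s (u n).2 - (u n).2 = (S s y - y) + (S s ((u n).2 - y) - ((u n).2 - y)) := by
      rw [map_sub]; abel
    rw [h2]
    refine (norm_add_le _ _).trans ?_
    refine add_le_add h1 ((norm_sub_le _ _).trans ?_)
    have h3 : ‖S s ((u n).2 - y)‖ ≤ M * ‖(u n).2 - y‖ :=
      ((S s).le_opNorm _).trans (by gcongr; exact hM s ⟨hs.1, hs.2.trans ht1.le⟩)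
    linarith
  have hL : Tendsto (fun n => ‖(u n).1 - S t (u n).1 - t • (u n).2‖) atTop
      (𝓝 ‖x - S t x - t • y‖) :=
    ((hx.sub (((S t).continuous.tendsto _).comp hx)).sub (hy.const_smul t)).norm
  have hR : Tendsto (fun n => (ε / 2 + (M + 1) * ‖(u n).2 - y‖) * t) atTop
      (𝓝 ((ε / 2 + (M + 1) * 0) * t)) := by
    refine Tendsto.mul_const _ (Tendsto.const_add _ (Tendsto.const_mul _ ?_))
    have := (hy.sub_const y).norm
    simpa using this
  have hfin : ‖x - S t x - t • y‖ ≤ ε / 2 * t := by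
    have := le_of_tendsto_of_tendsto' hL hR hbd
    simpa using this
  rw [dist_eq_norm, hsm]
  have h6 : t⁻¹ • (x - S t x) - y = t⁻¹ • (x - S t x - t • y) := by
    rw [smul_sub t⁻¹ (x - S t x), smul_smul, inv_mul_cancel₀ ht0'.ne', one_smul]
  rw [h6, norm_smul, norm_inv, Real.norm_of_nonneg ht0'.le]
  calc t⁻¹ * ‖x - S t x - t • y‖ ≤ t⁻¹ * (ε / 2 * t) := by gcongr
    _ = ε / 2 := by field_simp
    _ < ε := by linarith

/-- The open sector `{z ≠ 0 : |arg z| < φ}`. -/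
def sector (φ : ℝ) : Set ℂ := {z | z ≠ 0 ∧ |z.arg| < φ}

/-- `S` is an analytic semigroup: it extends, on some sector `|arg z| < φ`, to a holomorphic family
`W(z) = U(z) + i V(z)` of bounded operators on the complexification of `E` with `W(z) x → x` as
`z → 0` in the sector. The first condition says that `W` is complex differentiable at each point of
the sector, with derivative `U' + i V'`, so that `W(z + h) = W(z) + h W'(z) + o(h)`. (For `𝕜 = ℂ`
this is the same as the existence of a holomorphic extension with values in the bounded
operators on `E`, namely `z ↦ U(z) + i V(z)`.) -/
def C0Semigroup.IsAnalytic (S : C0Semigroup 𝕜 E) : Prop :=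
  ∃ φ : ℝ, 0 < φ ∧ φ ≤ Real.pi / 2 ∧ ∃ U V : ℂ → E →L[𝕜] E,
    (∀ z ∈ sector φ, ∃ U' V' : E →L[𝕜] E,
      (fun h : ℂ => U (z + h) - U z - ((h.re : 𝕜) • U' - (h.im : 𝕜) • V')) =o[𝓝 0] (fun h => h) ∧
      (fun h : ℂ => V (z + h) - V z - ((h.re : 𝕜) • V' + (h.im : 𝕜) • U')) =o[𝓝 0] (fun h => h)) ∧
    (∀ t : ℝ, 0 < t → U t = S t ∧ V t = 0) ∧
    (∀ x : E, Tendsto (fun z => U z x) (𝓝[sector φ] 0) (𝓝 x) ∧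
      Tendsto (fun z => V z x) (𝓝[sector φ] 0) (𝓝 0))

/-- The bounded operator `A e^{-rA}` (for `r > 0` and an analytic semigroup; see
`C0Semigroup.opAExp_spec`). -/
def C0Semigroup.opAExp (S : C0Semigroup 𝕜 E) (r : ℝ) : E →L[𝕜] E :=
  open Classical in
  if h : ∃ B : E →L[𝕜] E, ∀ x, (S r x, B x) ∈ S.opA.graph then h.choose else 0

lemma C0Semigroup.IsAnalytic.exists_deriv {S : C0Semigroup 𝕜 E} (hS : S.IsAnalytic) {t : ℝ}
    (ht : 0 < t) : ∃ D : E →L[𝕜] E,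
      (fun h : ℝ => S (t + h) - S t - (h : 𝕜) • D) =o[𝓝 0] (fun h => h) := by
  obtain ⟨φ, hφ, -, U, V, hder, hreal, -⟩ := hS
  have hmem : (t : ℂ) ∈ sector φ := by
    refine ⟨by exact_mod_cast ht.ne', ?_⟩
    rw [Complex.arg_ofReal_of_nonneg ht.le]
    simpa using hφ
  obtain ⟨U', V', hU, -⟩ := hder t hmem
  refine ⟨U', ?_⟩
  have hc : Tendsto (fun h : ℝ => (h : ℂ)) (𝓝 0) (𝓝 0) := by
    have := Complex.continuous_ofReal.tendsto (0 : ℝ)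
    simpa using this
  have h1 := hU.comp_tendsto hc
  have h2 : (fun h : ℝ => S (t + h) - S t - (h : 𝕜) • U') =o[𝓝 0] (fun h : ℝ => (h : ℂ)) := by
    refine h1.congr' ?_ EventuallyEq.rfl
    have hev : ∀ᶠ h : ℝ in 𝓝 0, -t < h := Ioi_mem_nhds (by linarith)
    filter_upwards [hev] with h hh
    simp only [Function.comp_apply, Complex.ofReal_re, Complex.ofReal_im]
    rw [← Complex.ofReal_add, (hreal _ (by linarith : 0 < t + h)).1, (hreal t ht).1]
    simp
  exact h2.trans_isBigO (Asymptotics.isBigO_of_le _ fun h => by simp)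

lemma C0Semigroup.IsAnalytic.continuousAt {S : C0Semigroup 𝕜 E} (hS : S.IsAnalytic) {t : ℝ}
    (ht : 0 < t) : ContinuousAt (fun s => S s) t := by
  obtain ⟨D, hD⟩ := hS.exists_deriv ht
  have h0 : Tendsto (fun h : ℝ => h) (𝓝 0) (𝓝 0) := tendsto_id
  have h1 : Tendsto (fun h : ℝ => S (t + h) - S t - (h : 𝕜) • D) (𝓝 0) (𝓝 0) :=
    hD.trans_tendsto h0
  have h2 : Tendsto (fun h : ℝ => (h : 𝕜) • D) (𝓝 0) (𝓝 0) := by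
    have : Tendsto (fun h : ℝ => (h : 𝕜) • D) (𝓝 0) (𝓝 (((0 : ℝ) : 𝕜) • D)) :=
      (RCLike.continuous_ofReal.tendsto 0).smul_const D
    simpa using this
  have h3 : Tendsto (fun h : ℝ => S (t + h)) (𝓝 0) (𝓝 (S t)) := by
    have := (h1.add h2).add_const (S t)
    simpa using this
  have h4 : Tendsto (fun s : ℝ => s - t) (𝓝 t) (𝓝 0) := by
    have : Tendsto (fun s : ℝ => s - t) (𝓝 t) (𝓝 (t - t)) := Continuous.tendsto (by fun_prop) t
    simpa using this
  have h5 := h3.comp h4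
  refine h5.congr fun s => ?_
  simp

lemma C0Semigroup.IsAnalytic.exists_AExp {S : C0Semigroup 𝕜 E} (hS : S.IsAnalytic) {t : ℝ}
    (ht : 0 < t) : ∃ B : E →L[𝕜] E, ∀ x, (S t x, B x) ∈ S.opA.graph := by
  obtain ⟨D, hD⟩ := hS.exists_deriv ht
  refine ⟨-D, fun x => ?_⟩
  rw [S.mem_graph_iff]
  have h1 : Tendsto (fun h : ℝ => (h : 𝕜)⁻¹ • (S (t + h) - S t - (h : 𝕜) • D)) (𝓝[>] 0) (𝓝 0) := by
    rw [tendsto_zero_iff_norm_tendsto_zero]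
    have h2 := (hD.norm_norm.tendsto_div_nhds_zero).mono_left
      (nhdsWithin_le_nhds (s := Ioi (0 : ℝ)))
    refine h2.congr fun h => ?_
    rw [norm_smul, norm_inv, RCLike.norm_ofReal, Real.norm_eq_abs, div_eq_inv_mul]
  have h3 : Tendsto (fun h : ℝ => ((h : 𝕜)⁻¹ • (S (t + h) - S t - (h : 𝕜) • D)) x)
      (𝓝[>] 0) (𝓝 0) := by
    have := ((ContinuousLinearMap.apply 𝕜 E x).continuous.tendsto 0).comp h1
    rw [_root_.map_zero] at this
    exact this
  have h4 := (h3.neg.sub_const (D x))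
  simp only [neg_zero, zero_sub] at h4
  refine h4.congr' ?_
  filter_upwards [self_mem_nhdsWithin] with h hh
  have hh' : (0 : ℝ) < h := hh
  have hne : (h : 𝕜) ≠ 0 := by exact_mod_cast hh'.ne'
  have h5 : S (t + h) x = S h (S t x) := by
    rw [add_comm, S.map_add _ _ hh'.le ht.le]; rfl
  simp only [_root_.smul_apply, _root_.sub_apply, h5, smul_sub,
    smul_smul, inv_mul_cancel₀ hne, one_smul]
  abel

/-- For an analytic semigroup and `r > 0`, `e^{-rA}` maps `E` into the domain of `A`, and `opAExp r`
is the operator `A e^{-rA}`. -/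
lemma C0Semigroup.opAExp_spec {S : C0Semigroup 𝕜 E} (hS : S.IsAnalytic) {r : ℝ} (hr : 0 < r)
    (x : E) : ∃ hx : S r x ∈ S.opA.domain, S.opA ⟨S r x, hx⟩ = S.opAExp r x := by
  have hex := hS.exists_AExp hr
  have h := hex.choose_spec x
  have h2 : S.opAExp r = hex.choose := dif_pos hex
  rw [← h2, LinearPMap.mem_graph_iff] at h
  obtain ⟨⟨z, hz⟩, h3, h4⟩ := h
  have h3' : z = S r x := h3
  subst h3'
  exact ⟨hz, h4⟩

end Semigroup

/-- The Banach space `D(A)`: the domain of `A` with (the maximum form of) its graph norm, realized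
as the graph of `A`. -/
def domSp {𝕜 : Type k} [RCLike 𝕜] {E : BanachSp.{k, u} 𝕜} (S : C0Semigroup 𝕜 E) :
    BanachSp.{k, u} 𝕜 :=
  haveI : CompleteSpace S.opA.graph := S.isClosed_graph.completeSpace_coe
  ⟨S.opA.graph⟩

/-- The inclusion of `D(A)` in `E`. -/
def domIncl {𝕜 : Type k} [RCLike 𝕜] {E : BanachSp.{k, u} 𝕜} (S : C0Semigroup 𝕜 E) :
    domSp S →L[𝕜] E :=
  (ContinuousLinearMap.fst 𝕜 E E).comp S.opA.graph.subtypeL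

/-- The Banach space `D_A(θ, q) = (E, D(A))_{θ,q}`. -/
def interpDom {𝕜 : Type k} [RCLike 𝕜] {E : BanachSp.{k, u} 𝕜} (S : C0Semigroup 𝕜 E)
    (θ q : ℝ) (hq : 1 ≤ q) : BanachSp.{k, u} 𝕜 :=
  interpSp E (domSp S) (ContinuousLinearMap.id 𝕜 E) (domIncl S) θ q hq

/-- The norm of `D_A(θ, q)`, as a function on `E` with value `∞` outside `D_A(θ, q)`. -/
def interpDomENorm {𝕜 : Type k} [RCLike 𝕜] {E : BanachSp.{k, u} 𝕜} (S : C0Semigroup 𝕜 E)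
    (θ q : ℝ) (x : E) : ℝ≥0∞ :=
  interpENorm (ContinuousLinearMap.id 𝕜 E) (domIncl S) θ q x

/-- The inclusion of `D_A(θ, q)` in `E`. -/
def interpDomIncl {𝕜 : Type k} [RCLike 𝕜] {E : BanachSp.{k, u} 𝕜} (S : C0Semigroup 𝕜 E)
    (θ q : ℝ) (hq : 1 ≤ q) : interpDom S θ q hq →L[𝕜] E :=
  interpIncl (ContinuousLinearMap.id 𝕜 E) (domIncl S) θ q hq

/-! ### Predictable processes -/

/-- Lebesgue measure on `[0, ∞)`. -/
def timeMeasure : Measure ℝ≥0 := Measure.comap ((↑) : ℝ≥0 → ℝ) volume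

lemma timeMeasure_map : Measure.map ((↑) : ℝ≥0 → ℝ) timeMeasure = volume.restrict (Ici 0) := by
  rw [timeMeasure]
  have h : MeasurableEmbedding ((↑) : ℝ≥0 → ℝ) := MeasurableEmbedding.subtype_coe measurableSet_Ici
  rw [h.map_comap]
  congr 1
  exact NNReal.range_coe

instance : SFinite timeMeasure := by
  have h : timeMeasure = Measure.map Real.toNNReal (volume.restrict (Ici 0)) := by
    rw [← timeMeasure_map, Measure.map_map (by fun_prop) (by fun_prop)]
    have : Real.toNNReal ∘ ((↑) : ℝ≥0 → ℝ) = id := by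
      ext x; simp
    rw [this, Measure.map_id]
  rw [h]
  infer_instance

section Processes

variable {Ω : Type w} {m : MeasurableSpace Ω}

lemma predictable_le (𝓕 : Filtration ℝ≥0 m) :
    𝓕.predictable ≤ (inferInstance : MeasurableSpace (ℝ≥0 × Ω)) := by
  refine measurableSpace_le_predictable_of_measurableSet (fun A hA => ?_) fun i A hA => ?_
  · exact (measurableSet_singleton _).prod (𝓕.le _ _ hA)
  · exact measurableSet_Ioi.prod (𝓕.le _ _ hA)

lemma measurable_fst_predictable (𝓕 : Filtration ℝ≥0 m) :
    Measurable[𝓕.predictable] (Prod.fst : ℝ≥0 × Ω → ℝ≥0) := by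
  let _ : MeasurableSpace (ℝ≥0 × Ω) := 𝓕.predictable
  refine measurable_of_Ioi fun i => ?_
  have : (Prod.fst : ℝ≥0 × Ω → ℝ≥0) ⁻¹' Ioi i = Ioi i ×ˢ univ := by ext; simp
  rw [this]
  exact measurableSet_predictable_Ioi_prod MeasurableSet.univ

variable {𝕜 : Type k} [RCLike 𝕜] (P : Measure Ω) (𝓕 : Filtration ℝ≥0 m) (p : ℝ) (hp : 1 < p)
  {X : Type u} [NormedAddCommGroup X] [NormedSpace 𝕜 X]
  {Y : Type v} [NormedAddCommGroup Y] [NormedSpace 𝕜 Y]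

lemma measurable_enorm_rpow {ξ : ℝ≥0 → Ω → X} (hξ : IsStronglyPredictable 𝓕 ξ) :
    Measurable (fun z : Ω × ℝ≥0 => ‖ξ z.2 z.1‖ₑ ^ p) := by
  have h1 : StronglyMeasurable (Function.uncurry ξ) :=
     StronglyMeasurable.mono hξ (predictable_le 𝓕)
  have h2 : Measurable (fun z : ℝ≥0 × Ω => ‖ξ z.1 z.2‖ₑ ^ p) := h1.enorm.pow_const p
  exact h2.comp measurable_swap

/-- The space `M^p_loc(X)` of predictable `X`-valued processes `ξ` with
`𝔼 ∫₀ᵀ ‖ξ(s)‖^p ds < ∞` for all `T`. -/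
def Mloc : Submodule 𝕜 (ℝ≥0 → Ω → X) where
  carrier := {ξ | IsStronglyPredictable 𝓕 ξ ∧
    ∀ T : ℝ≥0, ∫⁻ ω, ∫⁻ s in Icc 0 T, ‖ξ s ω‖ₑ ^ p ∂timeMeasure ∂P < ∞}
  add_mem' := by
    rintro ξ η ⟨hξ, hξ'⟩ ⟨hη, hη'⟩
    refine ⟨StronglyMeasurable.add hξ hη, fun T => ?_⟩
    have hle : ∀ ω s, ‖(ξ + η) s ω‖ₑ ^ p ≤
        (2 : ℝ≥0∞) ^ (p - 1) * ‖ξ s ω‖ₑ ^ p + (2 : ℝ≥0∞) ^ (p - 1) * ‖η s ω‖ₑ ^ p := by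
      intro ω s
      rw [← mul_add]
      refine le_trans ?_ (ENNReal.rpow_add_le_mul_rpow_add_rpow _ _ hp.le)
      exact ENNReal.rpow_le_rpow (enorm_add_le _ _) (by linarith)
    have mξ := measurable_enorm_rpow 𝓕 p hξ
    have mη := measurable_enorm_rpow 𝓕 p hη
    have mξ' : Measurable fun ω => ∫⁻ s in Icc 0 T, ‖ξ s ω‖ₑ ^ p ∂timeMeasure :=
      mξ.lintegral_prod_right'
    have mη' : Measurable fun ω => ∫⁻ s in Icc 0 T, ‖η s ω‖ₑ ^ p ∂timeMeasure :=
      mη.lintegral_prod_right'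
    have hc : (2 : ℝ≥0∞) ^ (p - 1) < ∞ :=
      ENNReal.rpow_lt_top_of_nonneg (by linarith) ENNReal.ofNat_ne_top
    calc ∫⁻ ω, ∫⁻ s in Icc 0 T, ‖(ξ + η) s ω‖ₑ ^ p ∂timeMeasure ∂P
        ≤ ∫⁻ ω, ∫⁻ s in Icc 0 T, ((2 : ℝ≥0∞) ^ (p - 1) * ‖ξ s ω‖ₑ ^ p +
            (2 : ℝ≥0∞) ^ (p - 1) * ‖η s ω‖ₑ ^ p) ∂timeMeasure ∂P :=
          lintegral_mono fun ω => lintegral_mono fun s => hle ω s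
      _ = ∫⁻ ω, ((2 : ℝ≥0∞) ^ (p - 1) * (∫⁻ s in Icc 0 T, ‖ξ s ω‖ₑ ^ p ∂timeMeasure) +
            (2 : ℝ≥0∞) ^ (p - 1) * (∫⁻ s in Icc 0 T, ‖η s ω‖ₑ ^ p ∂timeMeasure)) ∂P := by
          refine lintegral_congr fun ω => ?_
          have a1 : Measurable fun s => ‖ξ s ω‖ₑ ^ p := mξ.comp measurable_prodMk_left
          have a2 : Measurable fun s => ‖η s ω‖ₑ ^ p := mη.comp measurable_prodMk_left
          rw [lintegral_add_left (a1.const_mul _), lintegral_const_mul _ a1,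
            lintegral_const_mul _ a2]
      _ = (2 : ℝ≥0∞) ^ (p - 1) * (∫⁻ ω, ∫⁻ s in Icc 0 T, ‖ξ s ω‖ₑ ^ p ∂timeMeasure ∂P) +
            (2 : ℝ≥0∞) ^ (p - 1) * (∫⁻ ω, ∫⁻ s in Icc 0 T, ‖η s ω‖ₑ ^ p ∂timeMeasure ∂P) := by
          rw [lintegral_add_left (mξ'.const_mul _), lintegral_const_mul _ mξ',
            lintegral_const_mul _ mη']
      _ < ∞ := ENNReal.add_lt_top.2
          ⟨ENNReal.mul_lt_top hc (hξ' T), ENNReal.mul_lt_top hc (hη' T)⟩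
  zero_mem' := by
    have hp0 : 0 < p := by linarith
    exact ⟨@stronglyMeasurable_zero _ _ 𝓕.predictable _ _, fun T => by simp [hp0]⟩
  smul_mem' := by
    rintro c ξ ⟨hξ, hξ'⟩
    have hp0 : 0 < p := by linarith
    refine ⟨StronglyMeasurable.const_smul hξ c, fun T => ?_⟩
    have mξ := measurable_enorm_rpow 𝓕 p hξ
    have mξ' : Measurable fun ω => ∫⁻ s in Icc 0 T, ‖ξ s ω‖ₑ ^ p ∂timeMeasure :=
      mξ.lintegral_prod_right'
    have h1 : ∀ ω, ∫⁻ s in Icc 0 T, ‖(c • ξ) s ω‖ₑ ^ p ∂timeMeasure =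
        ‖c‖ₑ ^ p * ∫⁻ s in Icc 0 T, ‖ξ s ω‖ₑ ^ p ∂timeMeasure := by
      intro ω
      have a1 : Measurable fun s => ‖ξ s ω‖ₑ ^ p := mξ.comp measurable_prodMk_left
      rw [← lintegral_const_mul _ a1]
      refine lintegral_congr fun s => ?_
      rw [Pi.smul_apply, Pi.smul_apply, enorm_smul, ENNReal.mul_rpow_of_nonneg _ _ hp0.le]
    simp only [h1]
    rw [lintegral_const_mul _ mξ']
    exact ENNReal.mul_lt_top (ENNReal.rpow_lt_top_of_nonneg hp0.le (by simp)) (hξ' T)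

/-- If `Ψ` is a (deterministic) operator-valued function which is strongly measurable and locally
bounded in time, then `s ↦ Ψ(s) ξ(s)` belongs to `M^p_loc` whenever `ξ` does. -/
def Mloc.applyOp (Ψ : ℝ≥0 → X →L[𝕜] Y) (hΨ : StronglyMeasurable Ψ)
    (hb : ∃ M : ℝ≥0, ∀ s, ‖Ψ s‖ₑ ≤ M) :
    Mloc (𝕜 := 𝕜) P 𝓕 p hp (X := X) →ₗ[𝕜] Mloc (𝕜 := 𝕜) P 𝓕 p hp (X := Y) where
  toFun ξ := ⟨fun s ω => Ψ s (ξ.1 s ω), by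
    have hp0 : 0 < p := by linarith
    refine ⟨?_, fun T => ?_⟩
    · have h1 : StronglyMeasurable[𝓕.predictable] (fun z : ℝ≥0 × Ω => Ψ z.1) :=
        hΨ.comp_measurable (measurable_fst_predictable 𝓕)
      exact isBoundedBilinearMap_apply.continuous.comp_stronglyMeasurable (h1.prodMk ξ.2.1)
    · obtain ⟨M, hM⟩ := hb
      have mξ := measurable_enorm_rpow 𝓕 p ξ.2.1
      have mξ' : Measurable fun ω => ∫⁻ s in Icc 0 T, ‖ξ.1 s ω‖ₑ ^ p ∂timeMeasure :=
        mξ.lintegral_prod_right'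
      calc ∫⁻ ω, ∫⁻ s in Icc 0 T, ‖Ψ s (ξ.1 s ω)‖ₑ ^ p ∂timeMeasure ∂P
          ≤ ∫⁻ ω, ∫⁻ s in Icc 0 T, (M : ℝ≥0∞) ^ p * ‖ξ.1 s ω‖ₑ ^ p ∂timeMeasure ∂P := by
            refine lintegral_mono fun ω => lintegral_mono fun s => ?_
            dsimp only
            rw [← ENNReal.mul_rpow_of_nonneg _ _ hp0.le]
            refine ENNReal.rpow_le_rpow ?_ hp0.le
            exact ((Ψ s).le_opENorm _).trans (by gcongr; exact hM s)
        _ = (M : ℝ≥0∞) ^ p * ∫⁻ ω, ∫⁻ s in Icc 0 T, ‖ξ.1 s ω‖ₑ ^ p ∂timeMeasure ∂P := by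
            rw [← lintegral_const_mul _ mξ']
            refine lintegral_congr fun ω => ?_
            have a1 : Measurable fun s => ‖ξ.1 s ω‖ₑ ^ p := mξ.comp measurable_prodMk_left
            rw [lintegral_const_mul _ a1]
        _ < ∞ := ENNReal.mul_lt_top (ENNReal.rpow_lt_top_of_nonneg hp0.le (by simp)) (ξ.2.2 T)⟩
  map_add' ξ η := by
    ext s ω
    exact map_add (Ψ s) _ _
  map_smul' c ξ := by
    ext s ω
    exact map_smul (Ψ s) _ _

/-- The process `Φ ξ`, for a bounded operator `Φ`. -/
def Mloc.postcomp (Φ : X →L[𝕜] Y) :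
    Mloc (𝕜 := 𝕜) P 𝓕 p hp (X := X) →ₗ[𝕜] Mloc (𝕜 := 𝕜) P 𝓕 p hp (X := Y) :=
  Mloc.applyOp P 𝓕 p hp (fun _ => Φ) stronglyMeasurable_const ⟨‖Φ‖₊, fun _ => le_rfl⟩

end Processes

/-! ### The abstract setting -/

/-- The norm of `X`, transported to `Y` by a bounded operator `L : X → Y` and equal to `∞` outside
the range of `L` (when `L` is injective, this is the norm of `X` regarded as a subspace of `Y`). -/
def rangeENorm {𝕜 : Type k} [RCLike 𝕜] {X Y : BanachSp.{k, v} 𝕜} (L : X →L[𝕜] Y) (y : Y) : ℝ≥0∞ :=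
  ⨅ (x : X) (_ : L x = y), ‖x‖ₑ

/-- A class `cls` of separable Banach spaces; for each `E` in this class a separable Banach space
`R E`, on which bounded operators act functorially, linearly and with `‖Φ ξ‖ ≤ ‖Φ‖ ‖ξ‖`; and
linear operators `I E t : M^p_loc(R E) → L^p(Ω, 𝓕 t, P; E)` which commute with bounded operators,
`Φ (I_t ξ) = I_t (Φ ξ)`. (The objects `R E`, `map Φ`, `I E t` are irrelevant for spaces outside the
class.) -/
structure IntegralData (𝕜 : Type k) [RCLike 𝕜] {Ω : Type w} {m : MeasurableSpace Ω}
    (P : Measure Ω) (𝓕 : Filtration ℝ≥0 m) (p : ℝ) (hp : 1 < p) where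
  cls : Set (BanachSp.{k, u} 𝕜)
  separable : ∀ E ∈ cls, TopologicalSpace.SeparableSpace E
  R : BanachSp.{k, u} 𝕜 → BanachSp.{k, v} 𝕜
  separable_R : ∀ E ∈ cls, TopologicalSpace.SeparableSpace (R E)
  /-- `map Φ ξ` is the element `Φ ξ` of `R E₂`, for `Φ : E₁ → E₂` and `ξ` in `R E₁`. -/
  map : ∀ {E₁ E₂ : BanachSp.{k, u} 𝕜}, (E₁ →L[𝕜] E₂) →ₗ[𝕜] (R E₁ →L[𝕜] R E₂)
  map_id : ∀ E ∈ cls, map (ContinuousLinearMap.id 𝕜 E) = ContinuousLinearMap.id 𝕜 (R E)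
  map_comp : ∀ E₁ ∈ cls, ∀ E₂ ∈ cls, ∀ E₃ ∈ cls, ∀ (Ψ : E₂ →L[𝕜] E₃) (Φ : E₁ →L[𝕜] E₂),
    map (Ψ.comp Φ) = (map Ψ).comp (map Φ)
  norm_map_le : ∀ E₁ ∈ cls, ∀ E₂ ∈ cls, ∀ (Φ : E₁ →L[𝕜] E₂) (ξ : R E₁), ‖map Φ ξ‖ ≤ ‖Φ‖ * ‖ξ‖
  I : ∀ E : BanachSp.{k, u} 𝕜, ℝ≥0 →
    Mloc (𝕜 := 𝕜) P 𝓕 p hp (X := R E) →ₗ[𝕜] Lp E (ENNReal.ofReal p) P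
  adapted : ∀ E ∈ cls, ∀ t ξ, AEStronglyMeasurable[𝓕 t] (I E t ξ) P
  natural : ∀ E₁ ∈ cls, ∀ E₂ ∈ cls, ∀ (Φ : E₁ →L[𝕜] E₂) (t : ℝ≥0)
    (ξ : Mloc (𝕜 := 𝕜) P 𝓕 p hp (X := R E₁)),
    I E₂ t (Mloc.postcomp P 𝓕 p hp (map Φ) ξ) =ᵐ[P] fun ω => Φ (I E₁ t ξ ω)

namespace IntegralData

variable {𝕜 : Type k} [RCLike 𝕜] {Ω : Type w} {m : MeasurableSpace Ω}
  {P : Measure Ω} {𝓕 : Filtration ℝ≥0 m} {p : ℝ} {hp : 1 < p}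
  (D : IntegralData.{k, u, v, w} 𝕜 P 𝓕 p hp)

/-- The moment bound `𝔼 |I_t(ξ)|^p ≤ C 𝔼 ∫₀ᵗ ‖ξ(r)‖^p dr`, for each space `E` of the class. -/
def MomentBound : Prop :=
  ∀ E ∈ D.cls, ∃ C : ℝ≥0, ∀ (t : ℝ≥0) (ξ : Mloc (𝕜 := 𝕜) P 𝓕 p hp (X := D.R E)),
    ∫⁻ ω, ‖D.I E t ξ ω‖ₑ ^ p ∂P ≤
      C * ∫⁻ ω, ∫⁻ r in Icc 0 t, ‖ξ.1 r ω‖ₑ ^ p ∂timeMeasure ∂P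

/-- The class is closed under isomorphisms. -/
def IsoClosed : Prop :=
  ∀ E ∈ D.cls, ∀ E₁ : BanachSp.{k, u} 𝕜, Nonempty (E ≃L[𝕜] E₁) → E₁ ∈ D.cls

/-- For an interpolation couple (two spaces of the class, continuously embedded in
a Hausdorff topological vector space `Z`), the real interpolation spaces with second exponent `q`
belong to the class. -/
def InterpClosed (q : ℝ) (hq : 1 ≤ q) : Prop :=
  ∀ E₀ ∈ D.cls, ∀ E₁ ∈ D.cls, ∀ (Z : Type u) [AddCommGroup Z] [Module 𝕜 Z] [TopologicalSpace Z]
    [IsTopologicalAddGroup Z] [ContinuousSMul 𝕜 Z] [T2Space Z]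
    (i₀ : E₀ →L[𝕜] Z) (i₁ : E₁ →L[𝕜] Z), Function.Injective i₀ → Function.Injective i₁ →
    ∀ θ ∈ Ioo (0 : ℝ) 1, interpSp E₀ E₁ i₀ i₁ θ q hq ∈ D.cls

/-- The norm of `R(D_A(θ, q))`, as a function on `R(E)` with value `∞` outside `R(D_A(θ, q))`. -/
def relENorm {E : BanachSp.{k, u} 𝕜} (S : C0Semigroup 𝕜 E) (θ q : ℝ) (hq : 1 ≤ q)
    (ξ : D.R E) : ℝ≥0∞ :=
  rangeENorm (D.map (interpDomIncl S θ q hq)) ξ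

/-- For every `δ > 0` there is `K` with
`∫₀^δ ‖r^{1-θ} A e^{-rA} ξ‖^q_{R(E)} dr/r ≤ K^q ‖ξ‖^q_{R(D_A(θ,q))}`. -/
def SemigroupInterpBound {E : BanachSp.{k, u} 𝕜} (S : C0Semigroup 𝕜 E) (θ q : ℝ) (hq : 1 ≤ q) : Prop :=
  ∀ δ : ℝ, 0 < δ → ∃ K : ℝ≥0, ∀ ξ : D.R E,
    ∫⁻ r in Ioc 0 δ, (ENNReal.ofReal (r ^ (1 - θ)) * ‖D.map (S.opAExp r) ξ‖ₑ) ^ q ∂dtt ≤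
      (K : ℝ≥0∞) ^ q * D.relENorm S θ q hq ξ ^ q

/-- The moment bound `𝔼 |I_t(ξ)|^q ≤ C 𝔼 (∫₀ᵗ ‖ξ(r)‖^p dr)^{q/p}`. -/
def MomentBoundQ (E : BanachSp.{k, u} 𝕜) (q : ℝ) : Prop :=
  ∃ C : ℝ≥0, ∀ (t : ℝ≥0), 0 < t → ∀ (ξ : Mloc (𝕜 := 𝕜) P 𝓕 p hp (X := D.R E)),
    ∫⁻ ω, ‖D.I E t ξ ω‖ₑ ^ q ∂P ≤
      C * ∫⁻ ω, (∫⁻ r in Icc 0 t, ‖ξ.1 r ω‖ₑ ^ p ∂timeMeasure) ^ (q / p) ∂P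

lemma enorm_map_le {E₁ E₂ : BanachSp.{k, u} 𝕜} (h₁ : E₁ ∈ D.cls) (h₂ : E₂ ∈ D.cls)
    (Φ : E₁ →L[𝕜] E₂) : ‖D.map Φ‖ ≤ ‖Φ‖ :=
  ContinuousLinearMap.opNorm_le_bound _ (norm_nonneg _) (D.norm_map_le E₁ h₁ E₂ h₂ Φ)

/-- The operators `e^{-(t-r)A}`, acting from `R(E)` to `R(E)`, for `r ≤ t` (and `0` for `r > t`). -/
def convOp {E : BanachSp.{k, u} 𝕜} (S : C0Semigroup 𝕜 E) (t : ℝ≥0) (r : ℝ≥0) :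
    D.R E →L[𝕜] D.R E :=
  if r ≤ t then D.map (S ((t : ℝ) - r)) else 0

lemma stronglyMeasurable_convOp {E : BanachSp.{k, u} 𝕜} (hE : E ∈ D.cls) {S : C0Semigroup 𝕜 E}
    (hS : S.IsAnalytic) (t : ℝ≥0) : StronglyMeasurable (D.convOp S t) := by
  have hcont : Continuous (fun Φ : E →L[𝕜] E => D.map Φ) :=
    AddMonoidHomClass.continuous_of_bound (D.map (E₁ := E) (E₂ := E)) 1 fun Φ => by
      rw [one_mul]; exact D.enorm_map_le hE hE Φ
  refine stronglyMeasurable_of_restrict_of_restrict_compl (s := Iio t) measurableSet_Iio ?_ ?_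
  · refine Continuous.stronglyMeasurable ?_
    rw [← continuousOn_iff_continuous_domRestrict]
    have h1 : ContinuousOn (fun r : ℝ≥0 => D.map (S ((t : ℝ) - r))) (Iio t) := by
      refine hcont.comp_continuousOn fun r hr => ?_
      have hr' : (r : ℝ) < t := NNReal.coe_lt_coe.2 hr
      have h2 := hS.continuousAt (sub_pos.2 hr')
      have h3 : ContinuousAt (fun r : ℝ≥0 => (t : ℝ) - r) r := by fun_prop
      exact (ContinuousAt.comp (g := fun s => S s) (f := fun r : ℝ≥0 => (t : ℝ) - r) h2 h3).continuousWithinAt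
    refine h1.congr fun r hr => ?_
    exact if_pos (le_of_lt hr)
  · refine stronglyMeasurable_of_restrict_of_restrict_compl (s := {x | x.1 = t}) ?_ ?_ ?_
    · exact measurable_subtype_coe (measurableSet_singleton t)
    · have : ({x : ((Iio t)ᶜ : Set ℝ≥0) | x.1 = t}.domRestrict ((Iio t)ᶜ.domRestrict (D.convOp S t))) =
          fun _ => D.convOp S t t := by
        ext1 ⟨x, hx⟩
        have hx' : x.1 = t := hx
        simp [Set.domRestrict_apply, hx']
      rw [this]
      exact stronglyMeasurable_const
    · have : ({x : ((Iio t)ᶜ : Set ℝ≥0) | x.1 = t}ᶜ.domRestrict ((Iio t)ᶜ.domRestrict (D.convOp S t))) =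
          fun _ => 0 := by
        ext1 ⟨x, hx⟩
        have hx1 : x.1 ≠ t := hx
        have hx2 : t ≤ x.1 := not_lt.1 x.2
        simp only [Set.domRestrict_apply, convOp]
        exact if_neg (not_le.2 (lt_of_le_of_ne hx2 hx1.symm))
      rw [this]
      exact stronglyMeasurable_const

lemma exists_bound_convOp {E : BanachSp.{k, u} 𝕜} (hE : E ∈ D.cls) (S : C0Semigroup 𝕜 E)
    (t : ℝ≥0) : ∃ M : ℝ≥0, ∀ r, ‖D.convOp S t r‖ₑ ≤ M := by
  obtain ⟨M, hM1, hM⟩ := S.exists_bound t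
  refine ⟨M.toNNReal, fun r => ?_⟩
  rw [← ofReal_norm]
  refine ENNReal.ofReal_le_ofReal ?_
  rw [convOp]
  split_ifs with h
  · have h' : (r : ℝ) ≤ t := NNReal.coe_le_coe.2 h
    exact (D.enorm_map_le hE hE _).trans (hM _ ⟨by linarith, by linarith [r.2]⟩)
  · rw [norm_zero]; linarith

/-- The stochastic convolution `SC_t(ξ) = I_t(e^{-(t-·)A} ξ(·))`. -/
def SC {E : BanachSp.{k, u} 𝕜} (hE : E ∈ D.cls) {S : C0Semigroup 𝕜 E} (hS : S.IsAnalytic)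
    (t : ℝ≥0) : Mloc (𝕜 := 𝕜) P 𝓕 p hp (X := D.R E) →ₗ[𝕜] Lp E (ENNReal.ofReal p) P :=
  (D.I E t).comp (Mloc.applyOp P 𝓕 p hp (D.convOp S t) (D.stronglyMeasurable_convOp hE hS t)
    (D.exists_bound_convOp hE S t))

end IntegralData

end StochConv

end

/-!
Put `b = (1 - θ) p - 1`, which is positive because `θ < 1 - 1/p`, and `σ = θ + 1/p`, so that
`(1 - σ) q = b q / p`.

The norm of `D_A(σ, q)` is controlled by the semigroup: the decomposition
`x = (x - e^{-tA} x) + e^{-tA} x`, the identity `x - e^{-tA} x = ∫₀ᵗ A e^{-sA} x ds`, the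
invertibility of `A` and Hardy's inequality give
`‖x‖^q_{D_A(σ,q)} ≤ C ∫₀^∞ r^{(1-σ)q-1} ‖A e^{-rA} x‖^q dr` (`exists_interpDomENorm_rpow_le`).

For `x = SC_t(ξ)`, naturality of the integral gives `A e^{-rA} SC_t(ξ) = I_t(A e^{-(t-·+r)A} ξ)`,
and the moment bound of exponent `q` leads to `𝔼 (∫₀ᵗ ‖A e^{-(t-s+r)A} ξ(s)‖^p ds)^{q/p}`.
Jensen's inequality with the weight `(t-s+r)^{-1-b}`, of total mass at most `r^{-b} / b`, bounds
this by an integral of `q`-th powers (`IntegralData.lintegral_opAExp_SC_le`). All that is left is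
linear, and Tonelli's theorem with `u = t - s + r` in place of `t` gives
`𝔼 ∫ ds ∫₀^∞ du u^{(1+b)(q/p-1)} ‖A e^{-uA} ξ(s)‖^q ∫₀^u r^{b-1} dr`
(`lintegral_convolution_le`). The power of `u` adds up to `u^{(1-θ)q-1}`, so that the assumed bound
for `A e^{-uA}` on `R(D_A(θ, q))`, extended to `u ∈ (0, ∞)` by exponential stability
(`IntegralData.exists_lintegral_opAExpPos_le`), completes the proof. The statement about jointly
measurable versions follows by one more exchange of integrals, in the measurable semigroup
expression rather than in the interpolation norm.
-/

namespace StochConv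

universe k u v w

/-! ### Weighted inequalities on the half-line -/

/-- Jensen's inequality `(∫ f)^m ≤ (∫ w)^{m-1} ∫ f^m w^{1-m}` for the finite measure with
density `w`. -/
lemma lintegral_rpow_le_weighted {α : Type*} [MeasurableSpace α] {μ : Measure α}
    {f w : α → ℝ≥0∞} (hf : AEMeasurable f μ) (hw : AEMeasurable w μ)
    (hw0 : ∀ᵐ a ∂μ, w a ≠ 0) (hwt : ∀ᵐ a ∂μ, w a ≠ ∞) {m : ℝ} (hm : 1 ≤ m) :
    (∫⁻ a, f a ∂μ) ^ m ≤ (∫⁻ a, w a ∂μ) ^ (m - 1) * ∫⁻ a, f a ^ m * w a ^ (1 - m) ∂μ := by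
  rcases hm.eq_or_lt with rfl | hm1
  · simp
  have hm0 : 0 < m := by linarith
  -- Hölder's inequality for the product of `w ^ e` and `f * w ^ (-e)`
  have hc : (m / (m - 1)).HolderConjugate m := by
    have := (Real.HolderConjugate.conjExponent hm1).symm
    simpa [Real.conjExponent] using this
  set e : ℝ := (m - 1) / m with he
  have hm1' : m - 1 ≠ 0 := by linarith
  have h := ENNReal.lintegral_mul_le_Lp_mul_Lq μ hc (hw.pow_const e)
    (hf.mul (hw.pow_const (-e)))
  have h1 : ∫⁻ a, f a ∂μ = ∫⁻ a, ((fun a => w a ^ e) * (f * fun a => w a ^ (-e))) a ∂μ := by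
    refine lintegral_congr_ae ?_
    filter_upwards [hw0, hwt] with a h0 ht
    simp only [Pi.mul_apply]
    rw [mul_left_comm, ← ENNReal.rpow_add _ _ h0 ht]
    simp
  have h2 : ∀ a, (w a ^ e) ^ (m / (m - 1)) = w a := by
    intro a
    rw [← ENNReal.rpow_mul, he]
    field_simp
    simp
  have h3 : ∀ a, (f * fun a => w a ^ (-e)) a ^ m = f a ^ m * w a ^ (1 - m) := by
    intro a
    rw [Pi.mul_apply, ENNReal.mul_rpow_of_nonneg _ _ hm0.le, ← ENNReal.rpow_mul, he]
    congr 2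
    field_simp
    ring
  simp only [h2, h3] at h
  rw [← h1] at h
  calc (∫⁻ a, f a ∂μ) ^ m ≤ _ := ENNReal.rpow_le_rpow h hm0.le
    _ = _ := by
      rw [ENNReal.mul_rpow_of_nonneg _ _ hm0.le, ← ENNReal.rpow_mul, ← ENNReal.rpow_mul]
      congr 2
      · field_simp
      · rw [one_div_mul_cancel hm0.ne', ENNReal.rpow_one]

lemma lintegral_rpow_Ioo {a t : ℝ} (ha : 0 < a) (ht : 0 ≤ t) :
    ∫⁻ s in Ioo 0 t, ENNReal.ofReal (s ^ (a - 1)) = ENNReal.ofReal (t ^ a / a) := by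
  have hint : IntegrableOn (fun s : ℝ => s ^ (a - 1)) (Ioc 0 t) := by
    have := intervalIntegral.intervalIntegrable_rpow' (a := 0) (b := t) (r := a - 1) (by linarith)
    rwa [intervalIntegrable_iff_integrableOn_Ioc_of_le ht] at this
  rw [setLIntegral_congr Ioo_ae_eq_Ioc, ← ofReal_integral_eq_lintegral_ofReal hint]
  · rw [← intervalIntegral.integral_of_le ht, integral_rpow (Or.inl (by linarith))]
    simp [Real.zero_rpow ha.ne']
  · filter_upwards [ae_restrict_mem measurableSet_Ioc] with s hs
    exact Real.rpow_nonneg hs.1.le _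

lemma lintegral_rpow_Ioi {a r : ℝ} (ha : 0 < a) (hr : 0 < r) :
    ∫⁻ u in Ioi r, ENNReal.ofReal (u ^ (-1 - a)) = ENNReal.ofReal (r ^ (-a) / a) := by
  rw [← ofReal_integral_eq_lintegral_ofReal (integrableOn_Ioi_rpow_of_lt (by linarith) hr)]
  · rw [integral_Ioi_rpow_of_lt (by linarith) hr]
    congr 1
    rw [show -1 - a + 1 = -a by ring, neg_div_neg_eq]
  · filter_upwards [ae_restrict_mem measurableSet_Ioi] with s hs
    exact Real.rpow_nonneg (hr.trans hs).le _

/-- Tonelli's theorem on the triangle `0 < s < t`. -/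
lemma lintegral_triangle {F G : ℝ → ℝ≥0∞} (hF : Measurable F) (hG : Measurable G) :
    ∫⁻ t in Ioi 0, F t * ∫⁻ s in Ioo 0 t, G s = ∫⁻ s in Ioi 0, G s * ∫⁻ t in Ioi s, F t := by
  set H : ℝ → ℝ → ℝ≥0∞ := fun t s => {z : ℝ × ℝ | z.2 < z.1}.indicator (fun z => F z.1 * G z.2) (t, s)
  have hH : Measurable (Function.uncurry H) :=
    ((hF.comp measurable_fst).mul (hG.comp measurable_snd)).indicator
      (measurableSet_lt measurable_snd measurable_fst)
  have h1 : ∀ t ∈ Ioi (0 : ℝ), F t * ∫⁻ s in Ioo 0 t, G s = ∫⁻ s in Ioi 0, H t s := by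
    intro t _
    have hsub : Ioo 0 t = Iio t ∩ Ioi 0 := Ioi_inter_Iio.symm.trans (inter_comm _ _)
    rw [← lintegral_const_mul _ hG, hsub, ← Measure.restrict_restrict measurableSet_Iio,
      ← lintegral_indicator measurableSet_Iio]
    rfl
  have h2 : ∀ s ∈ Ioi (0 : ℝ), G s * ∫⁻ t in Ioi s, F t = ∫⁻ t in Ioi 0, H t s := by
    intro s hs
    have hsub : Ioi s ∩ Ioi 0 = Ioi s := inter_eq_left.2 (Ioi_subset_Ioi (le_of_lt hs))
    rw [← lintegral_const_mul _ hF, ← hsub, ← Measure.restrict_restrict measurableSet_Ioi,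
      ← lintegral_indicator measurableSet_Ioi]
    refine lintegral_congr fun t => ?_
    simp only [H, indicator, mem_Ioi, mem_ofPred_eq, mul_comm]
  rw [setLIntegral_congr_fun measurableSet_Ioi h1, setLIntegral_congr_fun measurableSet_Ioi h2]
  exact lintegral_lintegral_swap hH.aemeasurable

/-- Hardy's inequality for `t ↦ ∫₀ᵗ g`, with a power weight. -/
lemma lintegral_hardy {σ q : ℝ} (hσ : 0 < σ) (hq : 1 ≤ q) {g : ℝ → ℝ≥0∞} (hg : Measurable g) :
    ∫⁻ t in Ioi 0, ENNReal.ofReal (t ^ (-σ * q - 1)) * (∫⁻ s in Ioo 0 t, g s) ^ q ≤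
      ENNReal.ofReal (σ ^ (-q)) *
        ∫⁻ s in Ioi 0, ENNReal.ofReal (s ^ ((1 - σ) * q - 1)) * g s ^ q := by
  set G : ℝ → ℝ≥0∞ := fun s => g s ^ q * ENNReal.ofReal (s ^ ((1 - σ) * (q - 1))) with hG
  have hGm : Measurable G := by fun_prop
  set c : ℝ≥0∞ := ENNReal.ofReal (σ ^ (-(q - 1))) with hcdef
  have h1 : ∀ t ∈ Ioi (0 : ℝ), ENNReal.ofReal (t ^ (-σ * q - 1)) * (∫⁻ s in Ioo 0 t, g s) ^ q ≤
      c * (ENNReal.ofReal (t ^ (-1 - σ)) * ∫⁻ s in Ioo 0 t, G s) := by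
    intro t ht
    have ht' : (0 : ℝ) < t := ht
    -- the weight is `s^{σ-1}`
    have hJ := lintegral_rpow_le_weighted (μ := volume.restrict (Ioo 0 t)) (f := g)
      (w := fun s => ENNReal.ofReal (s ^ (σ - 1))) hg.aemeasurable (by fun_prop)
      (by
        filter_upwards [ae_restrict_mem measurableSet_Ioo] with s hs
        simpa using Real.rpow_pos_of_pos hs.1 _)
      (by simp) hq
    rw [lintegral_rpow_Ioo hσ ht'.le] at hJ
    have hJ2 : ∫⁻ s in Ioo 0 t, g s ^ q * ENNReal.ofReal (s ^ (σ - 1)) ^ (1 - q) =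
        ∫⁻ s in Ioo 0 t, G s := by
      refine setLIntegral_congr_fun measurableSet_Ioo fun s hs => ?_
      simp only [hG]
      rw [ENNReal.ofReal_rpow_of_pos (Real.rpow_pos_of_pos hs.1 _), ← Real.rpow_mul hs.1.le]
      congr 3
      ring
    rw [hJ2, ENNReal.ofReal_rpow_of_pos (by positivity)] at hJ
    refine (mul_le_mul_right hJ _).trans (le_of_eq ?_)
    rw [← mul_assoc, ← mul_assoc, hcdef, ← ENNReal.ofReal_mul (by positivity),
      ← ENNReal.ofReal_mul (by positivity)]
    congr 2
    rw [Real.div_rpow (by positivity) hσ.le, ← Real.rpow_mul ht'.le, div_eq_mul_inv,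
      ← Real.rpow_neg hσ.le, ← mul_assoc, ← Real.rpow_add ht', mul_comm]
    congr 2
    ring
  calc _ ≤ ∫⁻ t in Ioi 0, c * (ENNReal.ofReal (t ^ (-1 - σ)) * ∫⁻ s in Ioo 0 t, G s) :=
        setLIntegral_mono' measurableSet_Ioi h1
    _ = c * ∫⁻ s in Ioi 0, G s * ∫⁻ t in Ioi s, ENNReal.ofReal (t ^ (-1 - σ)) := by
        rw [lintegral_const_mul' _ _ ENNReal.ofReal_ne_top, lintegral_triangle (by fun_prop) hGm]
    _ = c * ∫⁻ s in Ioi 0, ENNReal.ofReal σ⁻¹ *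
          (ENNReal.ofReal (s ^ ((1 - σ) * q - 1)) * g s ^ q) := by
        congr 1
        refine setLIntegral_congr_fun measurableSet_Ioi fun s hs => ?_
        have hs' : (0 : ℝ) < s := hs
        simp only [hG]
        rw [lintegral_rpow_Ioi hσ hs', mul_assoc, ← ENNReal.ofReal_mul (by positivity), ← mul_assoc,
          ← ENNReal.ofReal_mul (by positivity), mul_comm]
        congr 2
        rw [div_eq_inv_mul, mul_left_comm, ← Real.rpow_add hs']
        congr 2
        ring
    _ = _ := by
        rw [lintegral_const_mul' _ _ ENNReal.ofReal_ne_top, ← mul_assoc, hcdef,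
          ← ENNReal.ofReal_mul (by positivity)]
        congr 2
        rw [← Real.rpow_neg_one, ← Real.rpow_add hσ]
        congr 1
        ring

lemma lintegral_dtt (s : Set ℝ) (hs : MeasurableSet s) (hs0 : s ⊆ Ioi 0) (f : ℝ → ℝ≥0∞)
    (hf : Measurable f) : ∫⁻ t in s, f t ∂dtt = ∫⁻ t in s, ENNReal.ofReal t⁻¹ * f t := by
  rw [dtt, restrict_withDensity hs, Measure.restrict_restrict hs, inter_eq_left.2 hs0,
    lintegral_withDensity_eq_lintegral_mul _ (by fun_prop) hf]
  rfl

lemma lintegral_dtt_univ (f : ℝ → ℝ≥0∞) (hf : Measurable f) :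
    ∫⁻ t, f t ∂dtt = ∫⁻ t in Ioi 0, ENNReal.ofReal t⁻¹ * f t := by
  rw [dtt, lintegral_withDensity_eq_lintegral_mul _ (by fun_prop) hf]
  rfl

lemma ofReal_inv_mul_weight {t : ℝ} (ht : 0 < t) (a : ℝ) {q : ℝ} (hq : 0 ≤ q) (x : ℝ≥0∞) :
    ENNReal.ofReal t⁻¹ * (ENNReal.ofReal (t ^ a) * x) ^ q =
      ENNReal.ofReal (t ^ (a * q - 1)) * x ^ q := by
  rw [ENNReal.mul_rpow_of_nonneg _ _ hq, ENNReal.ofReal_rpow_of_pos (by positivity),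
    ← Real.rpow_mul ht.le, ← mul_assoc, ← ENNReal.ofReal_mul (by positivity)]
  congr 2
  rw [← Real.rpow_neg_one, ← Real.rpow_add ht]
  congr 1
  ring

/-! ### The operators `A e^{-rA}` -/

section Semigroup

variable {𝕜 : Type k} [RCLike 𝕜] {E : Type u} [NormedAddCommGroup E] [NormedSpace 𝕜 E]
  {S : C0Semigroup 𝕜 E}

lemma C0Semigroup.graph_unique {x y y' : E} (h : (x, y) ∈ S.opA.graph)
    (h' : (x, y') ∈ S.opA.graph) : y = y' :=
  tendsto_nhds_unique ((S.mem_graph_iff _ _).1 h) ((S.mem_graph_iff _ _).1 h')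

lemma C0Semigroup.IsAnalytic.opAExp_mem_graph (hS : S.IsAnalytic) {r : ℝ} (hr : 0 < r) (x : E) :
    (S r x, S.opAExp r x) ∈ S.opA.graph := by
  obtain ⟨h, h'⟩ := C0Semigroup.opAExp_spec hS hr x
  exact (LinearPMap.mem_graph_iff _).2 ⟨_, rfl, h'⟩

lemma C0Semigroup.apply_add (S : C0Semigroup 𝕜 E) {s t : ℝ} (hs : 0 ≤ s) (ht : 0 ≤ t) (x : E) :
    S (s + t) x = S s (S t x) := by
  rw [S.map_add s t hs ht]; rfl

/-- The semigroup leaves `D(A)` invariant and commutes with `A`. -/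
lemma C0Semigroup.apply_mem_graph {s : ℝ} (hs : 0 ≤ s) {x y : E} (h : (x, y) ∈ S.opA.graph) :
    (S s x, S s y) ∈ S.opA.graph := by
  rw [S.mem_graph_iff] at h ⊢
  refine (((S s).continuous.tendsto _).comp h).congr' ?_
  filter_upwards [self_mem_nhdsWithin] with r hr
  have hr' : (0 : ℝ) ≤ r := le_of_lt hr
  simp only [Function.comp_apply]
  rw [map_smul, map_sub, ← S.apply_add hs hr', ← S.apply_add hr' hs, add_comm]

lemma C0Semigroup.IsAnalytic.opAExp_add (hS : S.IsAnalytic) {r s : ℝ} (hr : 0 < r) (hs : 0 ≤ s) :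
    S.opAExp (r + s) = (S.opAExp r).comp (S s) := by
  ext x
  have h := hS.opAExp_mem_graph (add_pos_of_pos_of_nonneg hr hs) x
  rw [S.apply_add hr.le hs] at h
  exact C0Semigroup.graph_unique h (hS.opAExp_mem_graph hr (S s x))

lemma C0Semigroup.IsAnalytic.opAExp_add' (hS : S.IsAnalytic) {r s : ℝ} (hr : 0 < r) (hs : 0 ≤ s) :
    S.opAExp (s + r) = (S s).comp (S.opAExp r) := by
  ext x
  have h := hS.opAExp_mem_graph (add_pos_of_nonneg_of_pos hs hr) x
  rw [S.apply_add hs hr.le] at h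
  exact C0Semigroup.graph_unique h (C0Semigroup.apply_mem_graph hs (hS.opAExp_mem_graph hr x))

lemma C0Semigroup.IsAnalytic.continuousOn_opAExp (hS : S.IsAnalytic) :
    ContinuousOn S.opAExp (Ioi 0) := by
  intro r hr
  have hr' : (0 : ℝ) < r := hr
  have h1 : ContinuousAt (fun t : ℝ => (S (t - r / 2)).comp (S.opAExp (r / 2))) r := by
    have h2 : ContinuousAt (fun t : ℝ => S (t - r / 2)) r :=
      ContinuousAt.comp (g := fun s => S s) (f := fun t : ℝ => t - r / 2)
        (hS.continuousAt (by linarith)) (by fun_prop)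
    exact h2.clm_comp continuousAt_const
  refine (h1.congr ?_).continuousWithinAt
  filter_upwards [Ioi_mem_nhds (show r / 2 < r by linarith)] with t ht
  have ht' : r / 2 < t := ht
  rw [← hS.opAExp_add' (by linarith) (by linarith)]
  congr 1
  ring

/-- The operator `A e^{-rA}` for `r > 0`, and `0` for `r ≤ 0`, where `S.opAExp r` may be a junk
value; the truncation makes it strongly measurable in `r`. -/
noncomputable def C0Semigroup.opAExpPos (S : C0Semigroup 𝕜 E) : ℝ → E →L[𝕜] E :=
  (Ioi 0).indicator S.opAExp

lemma C0Semigroup.opAExpPos_of_pos {r : ℝ} (hr : 0 < r) : S.opAExpPos r = S.opAExp r :=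
  indicator_of_mem (s := Ioi (0 : ℝ)) hr _

lemma C0Semigroup.IsAnalytic.stronglyMeasurable_opAExpPos (hS : S.IsAnalytic) :
    StronglyMeasurable S.opAExpPos := by
  refine stronglyMeasurable_of_restrict_of_restrict_compl (s := Ioi 0) measurableSet_Ioi ?_ ?_
  · refine Continuous.stronglyMeasurable ?_
    rw [← continuousOn_iff_continuous_domRestrict]
    exact hS.continuousOn_opAExp.congr fun r hr => C0Semigroup.opAExpPos_of_pos hr
  · have : (Ioi (0 : ℝ))ᶜ.domRestrict S.opAExpPos = fun _ => 0 := by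
      ext1 ⟨x, hx⟩
      exact indicator_of_notMem hx _
    rw [this]
    exact stronglyMeasurable_const

lemma C0Semigroup.IsAnalytic.measurable_enorm_opAExpPos (hS : S.IsAnalytic) (x : E) :
    Measurable fun r => ‖S.opAExpPos r x‖ₑ :=
  (isBoundedBilinearMap_apply.continuous.comp_stronglyMeasurable
    (hS.stronglyMeasurable_opAExpPos.prodMk (stronglyMeasurable_const (b := x)))).enorm

/-- The norm estimate that `x - e^{-τA} x = ∫₀^τ e^{-sA} A x ds` gives, for `x` in the domain
of `A`. -/
lemma C0Semigroup.enorm_sub_apply_le_of_mem_graph [CompleteSpace E] {x y : E}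
    (h : (x, y) ∈ S.opA.graph) {τ : ℝ} (hτ : 0 ≤ τ) : ‖x - S τ x‖ₑ ≤ ∫⁻ s in Ioc 0 τ, ‖S s y‖ₑ := by
  let _ : NormedSpace ℝ E := NormedSpace.restrictScalars ℝ 𝕜 E
  have hsm : ∀ (h : ℝ) (x : E), (((h : 𝕜))⁻¹) • x = h⁻¹ • x := fun h x => by
    rw [← RCLike.ofReal_inv]; rfl
  have hcy : ContinuousOn (fun s => S s y) (Icc 0 τ) :=
    (S.continuousOn y).mono fun s hs => hs.1
  have hcx : ContinuousOn (fun s => S s x) (Icc 0 τ) :=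
    (S.continuousOn x).mono fun s hs => hs.1
  have hder : ∀ s ∈ Ioo 0 τ, HasDerivWithinAt (fun s => S s x) (-(S s y)) (Ioi s) s := by
    intro s hs
    rw [hasDerivWithinAt_iff_tendsto_slope, sdiff_singleton_eq_self (by simp)]
    have h1 := (S.mem_graph_iff _ _).1 (C0Semigroup.apply_mem_graph hs.1.le h)
    have h2 : Tendsto (fun r : ℝ => r - s) (𝓝[>] s) (𝓝[>] 0) := by
      refine tendsto_nhdsWithin_iff.2 ⟨?_, ?_⟩
      · have : Tendsto (fun r : ℝ => r - s) (𝓝 s) (𝓝 (s - s)) :=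
          Continuous.tendsto (by fun_prop) s
        rw [sub_self] at this
        exact this.mono_left nhdsWithin_le_nhds
      · filter_upwards [self_mem_nhdsWithin] with r hr
        exact sub_pos_of_lt (α := ℝ) hr
    refine ((h1.comp h2).neg).congr' ?_
    filter_upwards [self_mem_nhdsWithin] with r hr
    have hr' : s < r := hr
    simp only [Function.comp_apply, slope_def_module]
    rw [hsm, ← S.apply_add (by linarith) hs.1.le, sub_add_cancel, ← smul_neg, neg_sub]
  have hint : IntervalIntegrable (fun s => -(S s y)) volume 0 τ := by
    refine ContinuousOn.intervalIntegrable ?_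
    rw [uIcc_of_le hτ]
    exact hcy.neg
  have hFTC := intervalIntegral.integral_eq_sub_of_hasDeriv_right_of_le hτ hcx hder hint
  rw [S.map_zero, ContinuousLinearMap.id_apply, intervalIntegral.integral_of_le hτ] at hFTC
  rw [enorm_sub_rev, ← hFTC]
  refine (enorm_integral_le_lintegral_enorm _).trans (le_of_eq ?_)
  simp only [enorm_neg]

/-- `x - e^{-tA} x = ∫₀ᵗ A e^{-sA} x ds` for all `x`, as the limit of the identity for
`e^{-εA} x`, which lies in the domain. -/
lemma C0Semigroup.IsAnalytic.enorm_sub_apply_le [CompleteSpace E] (hS : S.IsAnalytic) (x : E)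
    {t : ℝ} (ht : 0 < t) : ‖x - S t x‖ₑ ≤ ∫⁻ s in Ioo 0 t, ‖S.opAExpPos s x‖ₑ := by
  have hlim : Tendsto (fun ε => ‖S ε x - S t x‖ₑ) (𝓝[>] 0) (𝓝 ‖x - S t x‖ₑ) :=
    ((S.strongly_cont x).sub_const _).enorm
  refine le_of_tendsto hlim ?_
  filter_upwards [Ioo_mem_nhdsGT ht] with ε hε
  have h1 := C0Semigroup.enorm_sub_apply_le_of_mem_graph (hS.opAExp_mem_graph hε.1 x)
    (sub_nonneg.2 hε.2.le)
  rw [← S.apply_add (sub_nonneg.2 hε.2.le) hε.1.le, sub_add_cancel] at h1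
  refine h1.trans ?_
  have h2 : ∀ s ∈ Ioc 0 (t - ε), ‖S s (S.opAExp ε x)‖ₑ = ‖S.opAExpPos (s + ε) x‖ₑ := by
    intro s hs
    rw [C0Semigroup.opAExpPos_of_pos (add_pos hs.1 hε.1), hS.opAExp_add' hε.1 hs.1.le]
    rfl
  rw [setLIntegral_congr_fun measurableSet_Ioc h2, setLIntegral_congr Ioo_ae_eq_Ioc]
  have h3 := (measurePreserving_add_right volume ε).setLIntegral_comp_preimage
    (s := Ioc ε t) measurableSet_Ioc (hS.measurable_enorm_opAExpPos x)
  have h4 : (fun s => s + ε) ⁻¹' Ioc ε t = Ioc 0 (t - ε) := by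
    ext s; simp [le_sub_iff_add_le]
  rw [h4] at h3
  rw [h3]
  exact lintegral_mono_set (Ioc_subset_Ioc_left hε.1.le)

/-- Exponential stability makes `A` invertible: the norm of `D(A)` is equivalent to `‖A ·‖`. -/
lemma C0Semigroup.exists_norm_le_of_stable [CompleteSpace E]
    (hstable : ∃ C₀ ω₀ : ℝ, ω₀ < 0 ∧ ∀ t : ℝ, 0 ≤ t → ‖S t‖ ≤ C₀ * Real.exp (t * ω₀)) :
    ∃ c : ℝ≥0, ∀ x y : E, (x, y) ∈ S.opA.graph → ‖x‖ₑ ≤ c * ‖y‖ₑ := by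
  obtain ⟨C₀, ω₀, hω, hC⟩ := hstable
  -- choose `τ` with `‖e^{-τA}‖ ≤ 1/2`
  obtain ⟨τ, hτ0, hτ⟩ : ∃ τ : ℝ, 0 < τ ∧ C₀ * Real.exp (τ * ω₀) ≤ 1 / 2 := by
    have h1 : Tendsto (fun t : ℝ => C₀ * Real.exp (t * ω₀)) atTop (𝓝 (C₀ * 0)) :=
      (Real.tendsto_exp_atBot.comp (tendsto_id.atTop_mul_const_of_neg hω)).const_mul _
    rw [mul_zero] at h1
    obtain ⟨τ, h, h'⟩ := ((h1.eventually_le_const (by norm_num : (0 : ℝ) < 1 / 2)).and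
      (eventually_gt_atTop 0)).exists
    exact ⟨τ, h', h⟩
  obtain ⟨M, hM1, hM⟩ := S.exists_bound τ
  refine ⟨(2 * (M * τ)).toNNReal, fun x y hxy => ?_⟩
  have h1 : ‖x - S τ x‖ₑ ≤ ENNReal.ofReal (M * ‖y‖ * τ) := by
    calc _ ≤ ∫⁻ s in Ioc 0 τ, ‖S s y‖ₑ := C0Semigroup.enorm_sub_apply_le_of_mem_graph hxy hτ0.le
      _ ≤ ∫⁻ s in Ioc 0 τ, ENNReal.ofReal (M * ‖y‖) := by
          refine setLIntegral_mono' measurableSet_Ioc fun s hs => ?_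
          rw [← ofReal_norm]
          exact ENNReal.ofReal_le_ofReal
            (((S s).le_opNorm y).trans (by gcongr; exact hM s ⟨hs.1.le, hs.2⟩))
      _ = _ := by
          rw [setLIntegral_const, Real.volume_Ioc, sub_zero, ← ENNReal.ofReal_mul (by positivity)]
  rw [← ofReal_norm, ENNReal.ofReal_le_ofReal_iff (by positivity)] at h1
  have h2 : ‖S τ x‖ ≤ 1 / 2 * ‖x‖ :=
    ((S τ).le_opNorm x).trans (by gcongr; exact (hC τ hτ0.le).trans hτ)
  have h3 : ‖x‖ ≤ ‖x - S τ x‖ + ‖S τ x‖ := by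
    have := norm_add_le (x - S τ x) (S τ x)
    rwa [sub_add_cancel] at this
  rw [← ofReal_norm, ← ofReal_norm, ← ENNReal.ofReal_coe_nnreal,
    ← ENNReal.ofReal_mul (by positivity), Real.coe_toNNReal _ (by positivity)]
  exact ENNReal.ofReal_le_ofReal (by linarith)

end Semigroup

/-! ### The interpolation norm in terms of the semigroup -/

/-- `K(t, x) ≤ ∫₀ᵗ ‖A e^{-sA} x‖ ds + c t ‖A e^{-tA} x‖`, from the decomposition
`x = (x - e^{-tA} x) + e^{-tA} x`. -/
lemma exists_kFun_le {𝕜 : Type k} [RCLike 𝕜] {E : BanachSp.{k, u} 𝕜} {S : C0Semigroup 𝕜 E}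
    (hS : S.IsAnalytic)
    (hstable : ∃ C₀ ω₀ : ℝ, ω₀ < 0 ∧ ∀ t : ℝ, 0 ≤ t → ‖S t‖ ≤ C₀ * Real.exp (t * ω₀)) :
    ∃ c : ℝ≥0, ∀ (x : E) (t : ℝ), 0 < t →
      kFun (ContinuousLinearMap.id 𝕜 E) (domIncl S) t x ≤
        (∫⁻ s in Ioo 0 t, ‖S.opAExpPos s x‖ₑ) +
          c * (ENNReal.ofReal t * ‖S.opAExpPos t x‖ₑ) := by
  obtain ⟨c, hc⟩ := C0Semigroup.exists_norm_le_of_stable hstable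
  refine ⟨max c 1, fun x t ht => ?_⟩
  have hmem := hS.opAExp_mem_graph ht x
  let b : domSp S := (⟨(S t x, S.opAExp t x), hmem⟩ : S.opA.graph)
  refine (kFun_le (ContinuousLinearMap.id 𝕜 E) (domIncl S) (x - S t x) b ?_).trans
    (add_le_add (hS.enorm_sub_apply_le x ht) ?_)
  · change x - S t x + S t x = x
    rw [sub_add_cancel]
  · rw [mul_left_comm]
    gcongr
    rw [C0Semigroup.opAExpPos_of_pos ht]
    have hb : ‖b‖ₑ = max ‖S t x‖ₑ ‖S.opAExp t x‖ₑ := by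
      change ‖((S t x, S.opAExp t x) : E × E)‖ₑ = _
      rfl
    rw [hb]
    refine max_le ((hc _ _ hmem).trans ?_) ?_
    · gcongr; exact le_max_left _ _
    · calc ‖S.opAExp t x‖ₑ = (1 : ℝ≥0) * ‖S.opAExp t x‖ₑ := by simp
        _ ≤ _ := by gcongr; exact le_max_right _ _

/-- The estimate `‖x‖^q_{D_A(σ,q)} ≤ C ∫₀^∞ ‖t^{1-σ} A e^{-tA} x‖^q dt/t`, which follows from the
bound of `K(t, x)` by Hardy's inequality. -/
lemma exists_interpDomENorm_rpow_le {𝕜 : Type k} [RCLike 𝕜] {E : BanachSp.{k, u} 𝕜}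
    {S : C0Semigroup 𝕜 E} (hS : S.IsAnalytic)
    (hstable : ∃ C₀ ω₀ : ℝ, ω₀ < 0 ∧ ∀ t : ℝ, 0 ≤ t → ‖S t‖ ≤ C₀ * Real.exp (t * ω₀))
    {σ q : ℝ} (hσ : 0 < σ) (hq : 1 ≤ q) :
    ∃ C : ℝ≥0, ∀ x : E, interpDomENorm S σ q x ^ q ≤
      C * ∫⁻ t in Ioi 0, ENNReal.ofReal (t ^ ((1 - σ) * q - 1)) * ‖S.opAExpPos t x‖ₑ ^ q := by
  have hq0 : 0 < q := by linarith
  obtain ⟨c, hc⟩ := exists_kFun_le hS hstable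
  set C : ℝ≥0∞ := (2 : ℝ≥0∞) ^ (q - 1) * (ENNReal.ofReal (σ ^ (-q)) + (c : ℝ≥0∞) ^ q) with hC
  have hCt : C ≠ ∞ := by
    refine ENNReal.mul_ne_top (ENNReal.rpow_ne_top_of_nonneg (by linarith) (by simp)) ?_
    exact ENNReal.add_ne_top.2
      ⟨ENNReal.ofReal_ne_top, ENNReal.rpow_ne_top_of_nonneg hq0.le (by simp)⟩
  refine ⟨C.toNNReal, fun x => ?_⟩
  rw [ENNReal.coe_toNNReal hCt]
  have hg := hS.measurable_enorm_opAExpPos x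
  set g : ℝ → ℝ≥0∞ := fun t => ‖S.opAExpPos t x‖ₑ with hgdef
  set I : ℝ≥0∞ := ∫⁻ t in Ioi 0, ENNReal.ofReal (t ^ ((1 - σ) * q - 1)) * g t ^ q with hI
  have hpt : ∀ t ∈ Ioi (0 : ℝ), ENNReal.ofReal t⁻¹ *
      (ENNReal.ofReal (t ^ (-σ)) * kFun (ContinuousLinearMap.id 𝕜 E) (domIncl S) t x) ^ q ≤
      (2 : ℝ≥0∞) ^ (q - 1) *
        (ENNReal.ofReal (t ^ (-σ * q - 1)) * (∫⁻ s in Ioo 0 t, g s) ^ q +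
          (c : ℝ≥0∞) ^ q * (ENNReal.ofReal (t ^ ((1 - σ) * q - 1)) * g t ^ q)) := by
    intro t ht
    have ht' : (0 : ℝ) < t := ht
    have h1 := (ENNReal.rpow_le_rpow (hc x t ht') hq0.le).trans
      (ENNReal.rpow_add_le_mul_rpow_add_rpow _ _ hq)
    rw [ofReal_inv_mul_weight ht' _ hq0.le]
    refine (mul_le_mul_right h1 _).trans (le_of_eq ?_)
    rw [mul_left_comm, mul_add, ENNReal.mul_rpow_of_nonneg _ _ hq0.le,
      ENNReal.mul_rpow_of_nonneg _ _ hq0.le, ENNReal.ofReal_rpow_of_pos ht']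
    congr 2
    rw [mul_left_comm, ← mul_assoc (ENNReal.ofReal _), ← ENNReal.ofReal_mul (by positivity),
      ← Real.rpow_add ht']
    congr 4
    ring
  have hhead : Measurable fun t : ℝ => ∫⁻ s in Ioo 0 t, g s := by
    refine Monotone.measurable fun s t hst => ?_
    exact lintegral_mono_set (Ioo_subset_Ioo_right hst)
  have hmeas := measurable_weighted (ContinuousLinearMap.id 𝕜 E) (domIncl S) σ x
  calc interpDomENorm S σ q x ^ q
      = ∫⁻ t in Ioi 0, ENNReal.ofReal t⁻¹ *
        (ENNReal.ofReal (t ^ (-σ)) * kFun (ContinuousLinearMap.id 𝕜 E) (domIncl S) t x) ^ q := by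
        rw [interpDomENorm, interpENorm, ← ENNReal.rpow_mul, one_div_mul_cancel hq0.ne',
          ENNReal.rpow_one, lintegral_dtt_univ _ (hmeas.pow_const q)]
    _ ≤ ∫⁻ t in Ioi 0, (2 : ℝ≥0∞) ^ (q - 1) *
        (ENNReal.ofReal (t ^ (-σ * q - 1)) * (∫⁻ s in Ioo 0 t, g s) ^ q +
          (c : ℝ≥0∞) ^ q * (ENNReal.ofReal (t ^ ((1 - σ) * q - 1)) * g t ^ q)) :=
        setLIntegral_mono' measurableSet_Ioi hpt
    _ = (2 : ℝ≥0∞) ^ (q - 1) *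
        ((∫⁻ t in Ioi 0, ENNReal.ofReal (t ^ (-σ * q - 1)) * (∫⁻ s in Ioo 0 t, g s) ^ q) +
          (c : ℝ≥0∞) ^ q * I) := by
        rw [lintegral_const_mul _ (by fun_prop), lintegral_add_left (by fun_prop),
          lintegral_const_mul _ (by fun_prop)]
    _ ≤ (2 : ℝ≥0∞) ^ (q - 1) * (ENNReal.ofReal (σ ^ (-q)) * I + (c : ℝ≥0∞) ^ q * I) := by
        gcongr
        exact lintegral_hardy hσ hq hg
    _ = C * I := by rw [hC]; ring

/-! ### Time integrals -/

lemma timeMeasure_singleton_zero : timeMeasure {0} = 0 := by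
  have h : MeasurableEmbedding ((↑) : ℝ≥0 → ℝ) := MeasurableEmbedding.subtype_coe measurableSet_Ici
  rw [timeMeasure, h.comap_apply, image_singleton]
  simp

lemma lintegral_timeMeasure_le {A : Set ℝ} (hA : MeasurableSet A) {f : ℝ → ℝ≥0∞}
    (hf : Measurable f) :
    ∫⁻ t in ((↑) : ℝ≥0 → ℝ) ⁻¹' A, f t ∂timeMeasure ≤ ∫⁻ x in A, f x := by
  rw [← setLIntegral_map (g := ((↑) : ℝ≥0 → ℝ)) hA hf measurable_coe_nnreal_real, timeMeasure_map]
  exact lintegral_mono' (Measure.restrict_mono_measure Measure.restrict_le_self _) le_rfl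

lemma lintegral_shift_le {G : ℝ → ℝ≥0∞} (hG : Measurable G) (s : ℝ≥0) (r : ℝ) :
    ∫⁻ t in Ici s, G ((t : ℝ) - s + r) ∂timeMeasure ≤ ∫⁻ u in Ioi r, G u := by
  have h1 : Ici s = ((↑) : ℝ≥0 → ℝ) ⁻¹' Ici (s : ℝ) := by ext; simp
  have h2 : (fun t : ℝ => t + (r - s)) ⁻¹' Ici r = Ici (s : ℝ) := by
    ext t; simp only [mem_preimage, mem_Ici]; constructor <;> intro h <;> linarith
  have h3 := (measurePreserving_add_right volume (r - (s : ℝ))).setLIntegral_comp_preimage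
    (s := Ici r) measurableSet_Ici hG
  rw [h2] at h3
  rw [h1, setLIntegral_congr Ioi_ae_eq_Ici, ← h3]
  refine le_trans (le_of_eq ?_) (lintegral_timeMeasure_le measurableSet_Ici
    (f := fun t => G (t + (r - s))) (by fun_prop))
  refine lintegral_congr fun t => ?_
  congr 1
  ring

lemma lintegral_reflect_le {w : ℝ → ℝ≥0∞} (hw : Measurable w) (t : ℝ≥0) (r : ℝ) :
    ∫⁻ s in Icc 0 t, w ((t : ℝ) - s + r) ∂timeMeasure ≤ ∫⁻ u in Ioi r, w u := by
  have h1 : Icc 0 t = ((↑) : ℝ≥0 → ℝ) ⁻¹' Iic (t : ℝ) := by ext; simp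
  have h2 : (fun s : ℝ => (t + r) - s) ⁻¹' Ici r = Iic (t : ℝ) := by
    ext s; simp only [mem_preimage, mem_Ici, mem_Iic]; constructor <;> intro h <;> linarith
  have h3 := (Measure.measurePreserving_sub_left volume ((t : ℝ) + r)).setLIntegral_comp_preimage
    (s := Ici r) measurableSet_Ici hw
  rw [h2] at h3
  rw [h1, setLIntegral_congr Ioi_ae_eq_Ici, ← h3]
  refine le_trans (le_of_eq ?_) (lintegral_timeMeasure_le measurableSet_Iic
    (f := fun s => w ((t + r) - s)) (by fun_prop))
  refine lintegral_congr fun s => ?_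
  congr 1
  ring

/-- Tonelli's theorem for fourfold integrals, in the order that the main estimate needs. -/
lemma lintegral_swap_four {α β γ δ : Type*} [MeasurableSpace α] [MeasurableSpace β]
    [MeasurableSpace γ] [MeasurableSpace δ] {μ : Measure α} {ν : Measure β} {ρ : Measure γ}
    {τ : Measure δ} [SFinite μ] [SFinite ν] [SFinite ρ] [SFinite τ]
    {H : (α × β) × (γ × δ) → ℝ≥0∞} (hH : Measurable H) :
    ∫⁻ a, ∫⁻ b, ∫⁻ c, ∫⁻ d, H ((a, b), (c, d)) ∂τ ∂ρ ∂ν ∂μ =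
      ∫⁻ c, ∫⁻ d, ∫⁻ b, ∫⁻ a, H ((a, b), (c, d)) ∂μ ∂ν ∂τ ∂ρ := by
  have h1 : ∀ z : α × β, ∫⁻ c, ∫⁻ d, H (z, (c, d)) ∂τ ∂ρ = ∫⁻ y, H (z, y) ∂(ρ.prod τ) :=
    fun z => (lintegral_prod _ (hH.comp measurable_prodMk_left).aemeasurable).symm
  have h2 : ∀ y : γ × δ, ∫⁻ b, ∫⁻ a, H ((a, b), y) ∂μ ∂ν = ∫⁻ z, H (z, y) ∂(μ.prod ν) :=
    fun y => (lintegral_prod_symm _ (hH.comp measurable_prodMk_right).aemeasurable).symm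
  simp only [h1, h2]
  rw [← lintegral_prod (fun z => ∫⁻ y, H (z, y) ∂(ρ.prod τ))
      hH.lintegral_prod_right'.aemeasurable,
    ← lintegral_prod (fun y => ∫⁻ z, H (z, y) ∂(μ.prod ν)) hH.lintegral_prod_left'.aemeasurable]
  exact lintegral_lintegral_swap hH.aemeasurable

/-- Tonelli's theorem and translation invariance: the functions `G(s, ω, t - s + r)` are integrated
in `t` for fixed `s` and `r`, which leaves `∫₀ˣ r^{b-1} dr = x^b / b` as the weight of
`G(s, ω, x)`. -/
lemma lintegral_convolution_le {Ω : Type*} [MeasurableSpace Ω] {P : Measure Ω} [SFinite P]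
    {G : ℝ≥0 → Ω → ℝ → ℝ≥0∞} (hG : Measurable fun z : (ℝ≥0 × Ω) × ℝ => G z.1.1 z.1.2 z.2)
    {b : ℝ} (hb : 0 < b) (T : ℝ≥0) :
    ∫⁻ t in Icc 0 T, ∫⁻ r in Ioi 0, ENNReal.ofReal (r ^ (b - 1)) *
        ∫⁻ ω, ∫⁻ s in Icc 0 t, G s ω ((t : ℝ) - s + r) ∂timeMeasure ∂P ∂volume ∂timeMeasure ≤
      ENNReal.ofReal b⁻¹ * ∫⁻ ω, ∫⁻ s in Icc 0 T, ∫⁻ x in Ioi 0,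
        ENNReal.ofReal (x ^ b) * G s ω x ∂volume ∂timeMeasure ∂P := by
  obtain ⟨H, hH⟩ : ∃ H : (ℝ≥0 × ℝ) × (Ω × ℝ≥0) → ℝ≥0∞, H = fun z =>
      ENNReal.ofReal (z.1.2 ^ (b - 1)) *
        {z : (ℝ≥0 × ℝ) × (Ω × ℝ≥0) | z.2.2 ≤ z.1.1}.indicator
          (fun z => G z.2.2 z.2.1 ((z.1.1 : ℝ) - z.2.2 + z.1.2)) z := ⟨_, rfl⟩
  have hHm : Measurable H := by
    rw [hH]
    refine Measurable.mul (by fun_prop) (Measurable.indicator ?_ ?_)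
    · exact hG.comp (f := fun z : (ℝ≥0 × ℝ) × (Ω × ℝ≥0) =>
        ((z.2.2, z.2.1), (z.1.1 : ℝ) - z.2.2 + z.1.2)) (by fun_prop)
    · exact measurableSet_le (by fun_prop) (by fun_prop)
  have h1 : ∀ t ∈ Icc 0 T, ∫⁻ r in Ioi 0, ENNReal.ofReal (r ^ (b - 1)) *
        ∫⁻ ω, ∫⁻ s in Icc 0 t, G s ω ((t : ℝ) - s + r) ∂timeMeasure ∂P ∂volume =
      ∫⁻ r in Ioi 0, ∫⁻ ω, ∫⁻ s in Icc 0 T, H ((t, r), (ω, s)) ∂timeMeasure ∂P := by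
    intro t ht
    refine lintegral_congr fun r => ?_
    rw [← lintegral_const_mul' _ _ ENNReal.ofReal_ne_top]
    refine lintegral_congr fun ω => ?_
    have hsub : Icc 0 t = Iic t ∩ Icc 0 T := by
      ext s
      simp only [mem_Icc, mem_inter_iff, mem_Iic]
      exact ⟨fun h => ⟨h.2, h.1, h.2.trans ht.2⟩, fun h => ⟨h.2.1, h.1⟩⟩
    rw [hsub, ← Measure.restrict_restrict measurableSet_Iic,
      ← lintegral_indicator measurableSet_Iic, ← lintegral_const_mul' _ _ ENNReal.ofReal_ne_top, hH]
    rfl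
  rw [setLIntegral_congr_fun measurableSet_Icc h1, lintegral_swap_four hHm]
  rw [← lintegral_const_mul' _ _ ENNReal.ofReal_ne_top]
  refine lintegral_mono fun ω => ?_
  rw [← lintegral_const_mul' _ _ ENNReal.ofReal_ne_top]
  refine lintegral_mono fun s => ?_
  have hGs : Measurable (G s ω) := hG.comp (measurable_prodMk_left (x := (s, ω)))
  calc ∫⁻ r in Ioi 0, ∫⁻ t in Icc 0 T, H ((t, r), (ω, s)) ∂timeMeasure
      ≤ ∫⁻ r in Ioi 0, ENNReal.ofReal (r ^ (b - 1)) * ∫⁻ x in Ioi r, G s ω x := by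
        refine lintegral_mono fun r => ?_
        simp only [hH]
        rw [lintegral_const_mul' _ _ ENNReal.ofReal_ne_top]
        refine mul_le_mul_right ((setLIntegral_le_lintegral _ _).trans ?_) _
        refine le_trans (le_of_eq ?_) (lintegral_shift_le hGs s r)
        rw [← lintegral_indicator measurableSet_Ici]
        rfl
    _ = ∫⁻ x in Ioi 0, G s ω x * ∫⁻ r in Ioo 0 x, ENNReal.ofReal (r ^ (b - 1)) :=
        (lintegral_triangle hGs (by fun_prop)).symm
    _ = ∫⁻ x in Ioi 0, ENNReal.ofReal b⁻¹ * (ENNReal.ofReal (x ^ b) * G s ω x) := by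
        refine setLIntegral_congr_fun measurableSet_Ioi fun x hx => ?_
        have hx' : (0 : ℝ) < x := hx
        change G s ω x * ∫⁻ r in Ioo 0 x, ENNReal.ofReal (r ^ (b - 1)) = _
        rw [lintegral_rpow_Ioo hb hx'.le, div_eq_mul_inv, ENNReal.ofReal_mul (by positivity)]
        ring
    _ = _ := lintegral_const_mul' _ _ ENNReal.ofReal_ne_top

lemma summable_rpow_mul_exp (a C₀ : ℝ) (hC₀ : 0 ≤ C₀) {ω q : ℝ} (hω : ω < 0) (hq : 0 < q) :
    Summable fun n : ℕ => ((n : ℝ) + 1) ^ a * (C₀ * Real.exp (n * ω)) ^ q := by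
  have h1 := (Real.summable_pow_mul_exp_neg_nat_mul ⌈a⌉₊ (r := -(q * ω)) (by nlinarith))
  have h2 := ((summable_nat_add_iff 1).2 h1).mul_left (C₀ ^ q * Real.exp (-(q * ω)))
  refine Summable.of_nonneg_of_le (fun n => by positivity) (fun n => ?_) h2
  rw [Real.mul_rpow hC₀ (Real.exp_nonneg _), ← Real.exp_mul]
  have h3 : ((n : ℝ) + 1) ^ a ≤ ((n : ℝ) + 1) ^ ⌈a⌉₊ := by
    rw [← Real.rpow_natCast]
    exact Real.rpow_le_rpow_of_exponent_le (by linarith [n.cast_nonneg (α := ℝ)]) (Nat.le_ceil a)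
  have h4 : Real.exp (n * ω * q) =
      Real.exp (-(q * ω)) * Real.exp (-(-(q * ω)) * ((n + 1 : ℕ) : ℝ)) := by
    rw [← Real.exp_add]; congr 1; push_cast; ring
  rw [h4]
  push_cast
  calc _ ≤ ((n : ℝ) + 1) ^ ⌈a⌉₊ * (C₀ ^ q * (Real.exp (-(q * ω)) *
        Real.exp (-(-(q * ω)) * ((n : ℝ) + 1)))) := by gcongr
    _ = _ := by ring

namespace IntegralData

/-! ### The semigroup on `R(E)` -/

variable {𝕜 : Type k} [RCLike 𝕜] {Ω : Type w} {m : MeasurableSpace Ω}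
  {P : Measure Ω} {𝓕 : Filtration ℝ≥0 m} {p : ℝ} {hp : 1 < p}
  (D : IntegralData.{k, u, v, w} 𝕜 P 𝓕 p hp) {E : BanachSp.{k, u} 𝕜} {S : C0Semigroup 𝕜 E}

lemma map_comp_apply (hE : E ∈ D.cls) (Ψ Φ : E →L[𝕜] E) (ξ : D.R E) :
    D.map (Ψ.comp Φ) ξ = D.map Ψ (D.map Φ ξ) := by
  rw [D.map_comp E hE E hE E hE]; rfl

lemma stronglyMeasurable_map_opAExpPos (hE : E ∈ D.cls) (hS : S.IsAnalytic) :
    StronglyMeasurable fun r => D.map (S.opAExpPos r) := by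
  have hcont : Continuous (fun Φ : E →L[𝕜] E => D.map Φ) :=
    AddMonoidHomClass.continuous_of_bound (D.map (E₁ := E) (E₂ := E)) 1 fun Φ => by
      rw [one_mul]; exact D.enorm_map_le hE hE Φ
  exact hcont.comp_stronglyMeasurable hS.stronglyMeasurable_opAExpPos

lemma measurable_enorm_map_opAExpPos (hE : E ∈ D.cls) (hS : S.IsAnalytic) {α : Type*}
    [MeasurableSpace α] {f : α → ℝ} (hf : Measurable f) {x : α → D.R E}
    (hx : StronglyMeasurable x) : Measurable fun a => ‖D.map (S.opAExpPos (f a)) (x a)‖ₑ :=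
  (isBoundedBilinearMap_apply.continuous.comp_stronglyMeasurable
    (((D.stronglyMeasurable_map_opAExpPos hE hS).comp_measurable hf).prodMk hx)).enorm

/-- By exponential stability, the bound of `∫₀^δ ‖r^{1-θ} A e^{-rA} ξ‖^q dr/r` for finite `δ`
extends to `δ = ∞`: for `r = s + n` with `s ∈ (1, 2]` the operator `A e^{-rA} = e^{-nA} A e^{-sA}`
is compared with `A e^{-sA}`. -/
lemma exists_lintegral_opAExpPos_le (hE : E ∈ D.cls) (hS : S.IsAnalytic)
    (hstable : ∃ C₀ ω₀ : ℝ, ω₀ < 0 ∧ ∀ t : ℝ, 0 ≤ t → ‖S t‖ ≤ C₀ * Real.exp (t * ω₀))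
    {θ q : ℝ} (hq : 1 ≤ q) (hθ : 0 ≤ (1 - θ) * q - 1) (hsg : D.SemigroupInterpBound S θ q hq) :
    ∃ K : ℝ≥0, ∀ ξ : D.R E,
      ∫⁻ r in Ioi 0, ENNReal.ofReal (r ^ ((1 - θ) * q - 1)) * ‖D.map (S.opAExpPos r) ξ‖ₑ ^ q ≤
        K * D.relENorm S θ q hq ξ ^ q := by
  have hq0 : 0 < q := by linarith
  obtain ⟨C₀, ω₀, hω, hC⟩ := hstable
  have hC₀ : 0 ≤ C₀ := by
    have := (norm_nonneg _).trans (hC 0 le_rfl)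
    simpa using this
  obtain ⟨K, hK⟩ := hsg 2 (by norm_num)
  set a : ℝ := (1 - θ) * q - 1 with ha
  set c : ℕ → ℝ := fun n => ((n : ℝ) + 1) ^ a * (C₀ * Real.exp (n * ω₀)) ^ q with hc
  have hsum : Summable c := summable_rpow_mul_exp a C₀ hC₀ hω hq0
  set L : ℝ≥0∞ := 1 + ∑' n, ENNReal.ofReal (c n) with hL
  have hKL : L * (K : ℝ≥0∞) ^ q ≠ ∞ :=
    ENNReal.mul_ne_top (ENNReal.add_ne_top.2 ⟨by simp, hsum.tsum_ofReal_ne_top⟩)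
      (ENNReal.rpow_ne_top_of_nonneg hq0.le (by simp))
  refine ⟨(L * (K : ℝ≥0∞) ^ q).toNNReal, fun ξ => ?_⟩
  rw [ENNReal.coe_toNNReal hKL]
  have hg : Measurable fun r => ‖D.map (S.opAExpPos r) ξ‖ₑ :=
    D.measurable_enorm_map_opAExpPos hE hS measurable_id stronglyMeasurable_const
  set g : ℝ → ℝ≥0∞ := fun r => ‖D.map (S.opAExpPos r) ξ‖ₑ with hgdef
  set F : ℝ → ℝ≥0∞ := fun r => ENNReal.ofReal (r ^ a) * g r ^ q with hF
  have hFm : Measurable F := by fun_prop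
  set B : ℝ≥0∞ := ∫⁻ r in Ioc 0 2, F r with hB
  have hBK : B ≤ (K : ℝ≥0∞) ^ q * D.relENorm S θ q hq ξ ^ q := by
    refine le_trans (le_of_eq ?_) (hK ξ)
    have h1 : ∫⁻ r in Ioc (0 : ℝ) 2,
        (ENNReal.ofReal (r ^ (1 - θ)) * ‖D.map (S.opAExp r) ξ‖ₑ) ^ q ∂dtt =
        ∫⁻ r in Ioc (0 : ℝ) 2, (ENNReal.ofReal (r ^ (1 - θ)) * g r) ^ q ∂dtt := by
      refine setLIntegral_congr_fun measurableSet_Ioc fun r hr => ?_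
      simp only [hgdef, C0Semigroup.opAExpPos_of_pos hr.1]
    rw [h1, lintegral_dtt _ measurableSet_Ioc Ioc_subset_Ioi_self _ (by fun_prop)]
    refine setLIntegral_congr_fun measurableSet_Ioc fun r hr => ?_
    simp only [hF, ha]
    rw [ofReal_inv_mul_weight hr.1 _ hq0.le]
  have hstep : ∀ n : ℕ, ∫⁻ r in Ioc ((1 : ℝ) + n) (2 + n), F r ≤ ENNReal.ofReal (c n) * B := by
    intro n
    have h1 := (measurePreserving_add_right volume (n : ℝ)).setLIntegral_comp_preimage
      (s := Ioc ((1 : ℝ) + n) (2 + n)) measurableSet_Ioc hFm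
    have h2 : (fun s : ℝ => s + n) ⁻¹' Ioc ((1 : ℝ) + n) (2 + n) = Ioc 1 2 := by
      ext s; simp
    rw [h2] at h1
    rw [← h1, hB, ← lintegral_const_mul _ hFm]
    refine le_trans ?_ (lintegral_mono_set (Ioc_subset_Ioc_left zero_le_one))
    refine setLIntegral_mono' measurableSet_Ioc fun s hs => ?_
    have hs0 : (0 : ℝ) < s := by linarith [hs.1]
    have hn0 : (0 : ℝ) ≤ n := n.cast_nonneg
    have h3 : g (s + n) ≤ ENNReal.ofReal (C₀ * Real.exp (n * ω₀)) * g s := by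
      simp only [hgdef]
      rw [C0Semigroup.opAExpPos_of_pos hs0, C0Semigroup.opAExpPos_of_pos (by linarith),
        add_comm s, hS.opAExp_add' hs0 hn0, D.map_comp_apply hE]
      rw [← ofReal_norm, ← ofReal_norm, ← ENNReal.ofReal_mul (by positivity)]
      refine ENNReal.ofReal_le_ofReal ((D.norm_map_le E hE E hE _ _).trans ?_)
      gcongr
      exact hC n hn0
    have h4 : (s + n) ^ a ≤ (((n : ℝ) + 1) * s) ^ a := by
      refine Real.rpow_le_rpow (by positivity) ?_ hθ
      nlinarith [hs.1]
    calc F (s + n) ≤ ENNReal.ofReal ((((n : ℝ) + 1) * s) ^ a) *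
          (ENNReal.ofReal (C₀ * Real.exp (n * ω₀)) * g s) ^ q := by
          simp only [hF]
          gcongr
      _ = ENNReal.ofReal (c n) * F s := by
          rw [ENNReal.mul_rpow_of_nonneg _ _ hq0.le,
            ENNReal.ofReal_rpow_of_nonneg (by positivity) hq0.le,
            Real.mul_rpow (by positivity) hs0.le, ENNReal.ofReal_mul (by positivity), hc,
            ENNReal.ofReal_mul (by positivity)]
          simp only [hF]
          ring
  have hcover : Ioi (0 : ℝ) ⊆ Ioc 0 2 ∪ ⋃ n : ℕ, Ioc ((1 : ℝ) + n) (2 + n) := by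
    intro r hr
    have hr' : (0 : ℝ) < r := hr
    by_cases h2 : r ≤ 2
    · exact Or.inl ⟨hr', h2⟩
    · right
      push Not at h2
      have h5 : 2 < ⌈r⌉₊ := by exact_mod_cast h2.trans_le (Nat.le_ceil r)
      have h6 : (((⌈r⌉₊ - 2 : ℕ) : ℝ)) = (⌈r⌉₊ : ℝ) - 2 := by
        rw [Nat.cast_sub h5.le]; norm_num
      refine mem_iUnion.2 ⟨⌈r⌉₊ - 2, ?_, ?_⟩
      · rw [h6]; linarith [Nat.ceil_lt_add_one hr'.le]
      · rw [h6]; linarith [Nat.le_ceil r]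
  calc ∫⁻ r in Ioi 0, F r
      ≤ B + ∫⁻ r in ⋃ n : ℕ, Ioc ((1 : ℝ) + n) (2 + n), F r :=
        (lintegral_mono_set hcover).trans (lintegral_union_le _ _ _)
    _ ≤ B + ∑' n : ℕ, ENNReal.ofReal (c n) * B := by
        gcongr
        exact (lintegral_iUnion_le _ _).trans (ENNReal.tsum_le_tsum hstep)
    _ = L * B := by rw [ENNReal.tsum_mul_right, hL]; ring
    _ ≤ L * ((K : ℝ≥0∞) ^ q * D.relENorm S θ q hq ξ ^ q) := by gcongr
    _ = _ := by ring

/-! ### The stochastic convolution -/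

/-- `A e^{-rA} SC_t(ξ) = I_t(A e^{-(t-·+r)A} ξ)`, estimated by the moment bound of exponent `q` and
by Jensen's inequality with the weight `(t-s+r)^{-1-b}`; the result is linear in the
`q`-th powers. -/
lemma lintegral_opAExp_SC_le (hE : E ∈ D.cls) (hS : S.IsAnalytic) {q b : ℝ} (hpq : p ≤ q)
    (hb : 0 < b) {C : ℝ≥0}
    (hC : ∀ (t : ℝ≥0), 0 < t → ∀ (ξ : Mloc (𝕜 := 𝕜) P 𝓕 p hp (X := D.R E)),
      ∫⁻ ω, ‖D.I E t ξ ω‖ₑ ^ q ∂P ≤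
        C * ∫⁻ ω, (∫⁻ r in Icc 0 t, ‖ξ.1 r ω‖ₑ ^ p ∂timeMeasure) ^ (q / p) ∂P)
    (ξ : Mloc (𝕜 := 𝕜) P 𝓕 p hp (X := D.R E)) {t : ℝ≥0} (ht : 0 < t) {r : ℝ} (hr : 0 < r) :
    ∫⁻ ω, ‖S.opAExp r (D.SC hE hS t ξ ω)‖ₑ ^ q ∂P ≤
      C * (ENNReal.ofReal (r ^ (-(b * (q / p - 1))) * b ^ (-(q / p - 1))) *
        ∫⁻ ω, ∫⁻ s in Icc 0 t, ENNReal.ofReal (((t : ℝ) - s + r) ^ ((1 + b) * (q / p - 1))) *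
          ‖D.map (S.opAExpPos ((t : ℝ) - s + r)) (ξ.1 s ω)‖ₑ ^ q ∂timeMeasure ∂P) := by
  have hp0 : 0 < p := by linarith
  set n : ℝ := q / p with hn
  have hn1 : 1 ≤ n := (one_le_div hp0).2 hpq
  set η := Mloc.applyOp P 𝓕 p hp (D.convOp S t) (D.stronglyMeasurable_convOp hE hS t)
    (D.exists_bound_convOp hE S t) ξ with hη
  have hnat := D.natural E hE E hE (S.opAExp r) t η
  have hpos : ∀ s ∈ Icc 0 t, 0 < (t : ℝ) - s + r := by
    intro s hs
    have : (s : ℝ) ≤ t := hs.2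
    linarith
  have hval : ∀ ω, ∀ s ∈ Icc 0 t, (Mloc.postcomp P 𝓕 p hp (D.map (S.opAExp r)) η).1 s ω =
      D.map (S.opAExpPos ((t : ℝ) - s + r)) (ξ.1 s ω) := by
    intro ω s hs
    have hst : (s : ℝ) ≤ t := hs.2
    change D.map (S.opAExp r) (D.convOp S t s (ξ.1 s ω)) = _
    rw [convOp, if_pos hs.2, ← D.map_comp_apply hE, C0Semigroup.opAExpPos_of_pos (hpos s hs),
      add_comm ((t : ℝ) - s), hS.opAExp_add hr (sub_nonneg.2 hst)]
  have hξ : StronglyMeasurable (Function.uncurry ξ.1) :=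
    StronglyMeasurable.mono ξ.2.1 (predictable_le 𝓕)
  calc ∫⁻ ω, ‖S.opAExp r (D.SC hE hS t ξ ω)‖ₑ ^ q ∂P
      = ∫⁻ ω, ‖D.I E t (Mloc.postcomp P 𝓕 p hp (D.map (S.opAExp r)) η) ω‖ₑ ^ q ∂P := by
        refine lintegral_congr_ae ?_
        filter_upwards [hnat] with ω hω
        rw [hω]
        rfl
    _ ≤ C * ∫⁻ ω, (∫⁻ s in Icc 0 t,
          ‖(Mloc.postcomp P 𝓕 p hp (D.map (S.opAExp r)) η).1 s ω‖ₑ ^ p ∂timeMeasure) ^ n ∂P :=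
        hC t ht _
    _ ≤ C * ∫⁻ ω, ENNReal.ofReal (r ^ (-(b * (n - 1))) * b ^ (-(n - 1))) *
        (∫⁻ s in Icc 0 t, ENNReal.ofReal (((t : ℝ) - s + r) ^ ((1 + b) * (n - 1))) *
          ‖D.map (S.opAExpPos ((t : ℝ) - s + r)) (ξ.1 s ω)‖ₑ ^ q ∂timeMeasure) ∂P := by
        gcongr with ω
        have hf : Measurable fun s : ℝ≥0 =>
            ‖D.map (S.opAExpPos ((t : ℝ) - s + r)) (ξ.1 s ω)‖ₑ :=
          D.measurable_enorm_map_opAExpPos hE hS (by fun_prop)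
            (hξ.comp_measurable measurable_prodMk_right)
        set f : ℝ≥0 → ℝ≥0∞ := fun s => ‖D.map (S.opAExpPos ((t : ℝ) - s + r)) (ξ.1 s ω)‖ₑ
        have h1 : ∫⁻ s in Icc 0 t,
            ‖(Mloc.postcomp P 𝓕 p hp (D.map (S.opAExp r)) η).1 s ω‖ₑ ^ p ∂timeMeasure =
            ∫⁻ s in Icc 0 t, f s ^ p ∂timeMeasure :=
          setLIntegral_congr_fun measurableSet_Icc fun s hs => by
            rw [hval ω s hs]
        rw [h1]
        have hJ := lintegral_rpow_le_weighted (μ := timeMeasure.restrict (Icc 0 t))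
          (f := fun s => f s ^ p) (w := fun s => ENNReal.ofReal (((t : ℝ) - s + r) ^ (-1 - b)))
          (by fun_prop) (by fun_prop)
          (by
            filter_upwards [ae_restrict_mem measurableSet_Icc] with s hs
            simpa using Real.rpow_pos_of_pos (hpos s hs) _)
          (by simp) hn1
        refine hJ.trans (mul_le_mul' ?_ (le_of_eq ?_))
        · refine (ENNReal.rpow_le_rpow (lintegral_reflect_le
            (w := fun x => ENNReal.ofReal (x ^ (-1 - b))) (by fun_prop) t r)
              (by linarith)).trans (le_of_eq ?_)
          rw [lintegral_rpow_Ioi hb hr, ENNReal.ofReal_rpow_of_pos (by positivity),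
            Real.div_rpow (by positivity) hb.le, ← Real.rpow_mul hr.le, div_eq_mul_inv,
            ← Real.rpow_neg hb.le, neg_mul]
        · refine setLIntegral_congr_fun measurableSet_Icc fun s hs => ?_
          have hs0 := hpos s hs
          change (f s ^ p) ^ n * ENNReal.ofReal (((t : ℝ) - s + r) ^ (-1 - b)) ^ (1 - n) =
            ENNReal.ofReal (((t : ℝ) - s + r) ^ ((1 + b) * (n - 1))) * f s ^ q
          rw [ENNReal.ofReal_rpow_of_pos (by positivity), ← Real.rpow_mul hs0.le,
            ← ENNReal.rpow_mul, hn, mul_div_cancel₀ _ hp0.ne', mul_comm]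
          congr 3
          ring
    _ = _ := by rw [lintegral_const_mul' _ _ ENNReal.ofReal_ne_top]

/-- The moments of `A e^{-rA} SC_t(ξ)` for fixed `t > 0`, integrated in `r` with the weight
`r^{bn-1}`, `n = q/p`, which is the weight of the norm of `D_A(θ + 1/p, q)` when
`b = (1 - θ) p - 1`. -/
lemma lintegral_lintegral_opAExpPos_SC_le [SFinite P] (hE : E ∈ D.cls)
    (hS : S.IsAnalytic) {q b : ℝ} (hpq : p ≤ q) (hb : 0 < b) {C : ℝ≥0}
    (hC : ∀ (t : ℝ≥0), 0 < t → ∀ (ξ : Mloc (𝕜 := 𝕜) P 𝓕 p hp (X := D.R E)),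
      ∫⁻ ω, ‖D.I E t ξ ω‖ₑ ^ q ∂P ≤
        C * ∫⁻ ω, (∫⁻ r in Icc 0 t, ‖ξ.1 r ω‖ₑ ^ p ∂timeMeasure) ^ (q / p) ∂P)
    (ξ : Mloc (𝕜 := 𝕜) P 𝓕 p hp (X := D.R E)) {t : ℝ≥0} (ht : 0 < t) :
    ∫⁻ ω, ∫⁻ r in Ioi 0, ENNReal.ofReal (r ^ (b * (q / p) - 1)) *
        ‖S.opAExpPos r (D.SC hE hS t ξ ω)‖ₑ ^ q ∂volume ∂P ≤
      C * ENNReal.ofReal (b ^ (-(q / p - 1))) *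
        ∫⁻ r in Ioi 0, ENNReal.ofReal (r ^ (b - 1)) * ∫⁻ ω, ∫⁻ s in Icc 0 t,
          ENNReal.ofReal (((t : ℝ) - s + r) ^ ((1 + b) * (q / p - 1))) *
            ‖D.map (S.opAExpPos ((t : ℝ) - s + r)) (ξ.1 s ω)‖ₑ ^ q ∂timeMeasure ∂P := by
  have hX : StronglyMeasurable (D.SC hE hS t ξ) := Lp.stronglyMeasurable _
  have hXm : Measurable fun z : Ω × ℝ => ‖S.opAExpPos z.2 (D.SC hE hS t ξ z.1)‖ₑ :=
    (isBoundedBilinearMap_apply.continuous.comp_stronglyMeasurable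
      ((hS.stronglyMeasurable_opAExpPos.comp_measurable measurable_snd).prodMk
        (hX.comp_measurable measurable_fst))).enorm
  have hct : C * ENNReal.ofReal (b ^ (-(q / p - 1))) ≠ ∞ :=
    ENNReal.mul_ne_top (by simp) ENNReal.ofReal_ne_top
  rw [lintegral_lintegral_swap (Measurable.aemeasurable (by
    exact Measurable.mul (f := fun z : Ω × ℝ => ENNReal.ofReal (z.2 ^ (b * (q / p) - 1)))
      (by fun_prop) (hXm.pow_const q))), ← lintegral_const_mul' _ _ hct]
  refine setLIntegral_mono' measurableSet_Ioi fun r hr => ?_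
  have hr' : (0 : ℝ) < r := hr
  rw [lintegral_const_mul' _ _ ENNReal.ofReal_ne_top, C0Semigroup.opAExpPos_of_pos hr']
  refine (mul_le_mul_right (D.lintegral_opAExp_SC_le hE hS hpq hb hC ξ ht hr') _).trans
    (le_of_eq ?_)
  have h2 : ENNReal.ofReal (r ^ (b - 1)) = ENNReal.ofReal (r ^ (b * (q / p) - 1)) *
      ENNReal.ofReal (r ^ (-(b * (q / p - 1)))) := by
    rw [← ENNReal.ofReal_mul (by positivity), ← Real.rpow_add hr']
    congr 2
    ring
  rw [h2, ENNReal.ofReal_mul (by positivity)]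
  ring

/-- The estimate of the theorem, with the norm of `D_A(θ + 1/p, q)` expressed by the semigroup. -/
lemma exists_lintegral_SC_le [SFinite P] (hE : E ∈ D.cls) (hS : S.IsAnalytic)
    (hstable : ∃ C₀ ω₀ : ℝ, ω₀ < 0 ∧ ∀ t : ℝ, 0 ≤ t → ‖S t‖ ≤ C₀ * Real.exp (t * ω₀))
    {θ q : ℝ} (hpq : p ≤ q) (hθ : θ < 1 - 1 / p)
    (hsg : D.SemigroupInterpBound S θ q (hp.le.trans hpq)) (hmomentq : D.MomentBoundQ E q) :
    ∃ C : ℝ≥0, ∀ (T : ℝ≥0) (ξ : Mloc (𝕜 := 𝕜) P 𝓕 p hp (X := D.R E)),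
      ∫⁻ t in Icc 0 T, ∫⁻ ω, ∫⁻ r in Ioi 0,
          ENNReal.ofReal (r ^ ((1 - (θ + 1 / p)) * q - 1)) *
            ‖S.opAExpPos r (D.SC hE hS t ξ ω)‖ₑ ^ q ∂volume ∂P ∂timeMeasure ≤
        C * ∫⁻ ω, ∫⁻ s in Icc 0 T,
          D.relENorm S θ q (hp.le.trans hpq) (ξ.1 s ω) ^ q ∂timeMeasure ∂P := by
  have hp0 : 0 < p := by linarith
  have hq1 : 1 ≤ q := hp.le.trans hpq
  have hn1 : 1 ≤ q / p := (one_le_div hp0).2 hpq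
  -- `b > 0` is the condition `θ < 1 - 1/p`
  set b : ℝ := (1 - θ) * p - 1 with hbdef
  have hb : 0 < b := by
    have h1 : 1 / p < 1 - θ := by linarith
    have h2 := (div_lt_iff₀ hp0).1 h1
    linarith
  have he1 : (1 - (θ + 1 / p)) * q - 1 = b * (q / p) - 1 := by
    rw [hbdef]; field_simp; ring
  have he2 : (1 - θ) * q - 1 = b + (1 + b) * (q / p - 1) := by
    rw [hbdef]; field_simp; ring
  obtain ⟨C, hC⟩ := hmomentq
  obtain ⟨K, hK⟩ := D.exists_lintegral_opAExpPos_le hE hS hstable hq1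
    (by rw [he2]; nlinarith) hsg
  refine ⟨C * (b ^ (-(q / p - 1))).toNNReal * b⁻¹.toNNReal * K, fun T ξ => ?_⟩
  have hct : C * ENNReal.ofReal (b ^ (-(q / p - 1))) ≠ ∞ :=
    ENNReal.mul_ne_top (by simp) ENNReal.ofReal_ne_top
  have hξ : StronglyMeasurable (Function.uncurry ξ.1) :=
    StronglyMeasurable.mono ξ.2.1 (predictable_le 𝓕)
  have hGm : Measurable fun z : (ℝ≥0 × Ω) × ℝ =>
      ENNReal.ofReal (z.2 ^ ((1 + b) * (q / p - 1))) *
        ‖D.map (S.opAExpPos z.2) (ξ.1 z.1.1 z.1.2)‖ₑ ^ q := by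
    refine Measurable.mul (by fun_prop) (Measurable.pow_const ?_ _)
    exact D.measurable_enorm_map_opAExpPos hE hS measurable_snd (hξ.comp_measurable measurable_fst)
  have hconv := lintegral_convolution_le (P := P) (G := fun s ω x =>
    ENNReal.ofReal (x ^ ((1 + b) * (q / p - 1))) * ‖D.map (S.opAExpPos x) (ξ.1 s ω)‖ₑ ^ q)
    hGm hb T
  calc ∫⁻ t in Icc 0 T, ∫⁻ ω, ∫⁻ r in Ioi 0,
          ENNReal.ofReal (r ^ ((1 - (θ + 1 / p)) * q - 1)) *
            ‖S.opAExpPos r (D.SC hE hS t ξ ω)‖ₑ ^ q ∂volume ∂P ∂timeMeasure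
      ≤ ∫⁻ t in Icc 0 T, C * ENNReal.ofReal (b ^ (-(q / p - 1))) *
          ∫⁻ r in Ioi 0, ENNReal.ofReal (r ^ (b - 1)) * ∫⁻ ω, ∫⁻ s in Icc 0 t,
            ENNReal.ofReal (((t : ℝ) - s + r) ^ ((1 + b) * (q / p - 1))) *
              ‖D.map (S.opAExpPos ((t : ℝ) - s + r)) (ξ.1 s ω)‖ₑ ^ q
                ∂timeMeasure ∂P ∂volume ∂timeMeasure := by
        rw [he1]
        refine lintegral_mono_ae ?_
        -- the moment bound of exponent `q` is only available for `t > 0`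
        have h0 : ∀ᵐ t ∂timeMeasure, t ≠ 0 := by
          rw [ae_iff]; simpa using timeMeasure_singleton_zero
        filter_upwards [ae_restrict_of_ae h0] with t ht0
        exact D.lintegral_lintegral_opAExpPos_SC_le hE hS hpq hb hC ξ (pos_iff_ne_zero.2 ht0)
    _ ≤ C * ENNReal.ofReal (b ^ (-(q / p - 1))) * (ENNReal.ofReal b⁻¹ *
          ∫⁻ ω, ∫⁻ s in Icc 0 T, K * D.relENorm S θ q (hp.le.trans hpq) (ξ.1 s ω) ^ q
            ∂timeMeasure ∂P) := by
        rw [lintegral_const_mul' _ _ hct]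
        refine mul_le_mul_right (hconv.trans (mul_le_mul_right ?_ _)) _
        refine lintegral_mono fun ω => lintegral_mono fun s => le_trans (le_of_eq ?_) (hK _)
        refine setLIntegral_congr_fun measurableSet_Ioi fun x hx => ?_
        have hx' : (0 : ℝ) < x := hx
        change ENNReal.ofReal (x ^ b) * (_ * _) = ENNReal.ofReal (x ^ ((1 - θ) * q - 1)) * _
        rw [he2, Real.rpow_add hx', ENNReal.ofReal_mul (by positivity), mul_assoc]
    _ = _ := by
        simp only [lintegral_const_mul' _ _ (ENNReal.coe_ne_top (r := K))]
        push_cast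
        simp only [ENNReal.ofReal]
        ring

end IntegralData

end StochConv

theorem theorem2p2 {𝕜 : Type*} [RCLike 𝕜] {Ω : Type*} {m : MeasurableSpace Ω}
    (P : Measure Ω) [IsProbabilityMeasure P] (𝓕 : Filtration ℝ≥0 m)
    (p q : ℝ) (hp : 1 < p) (hp2 : p ≤ 2) (hpq : p ≤ q)
    -- the class of spaces, the spaces `R(E)` and the operators `I_t`, with their properties
    (D : StochConv.IntegralData 𝕜 P 𝓕 p hp)
    (hmoment : D.MomentBound) (hiso : D.IsoClosed) (hinterp : D.InterpClosed q (hp.le.trans hpq))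
    -- a space of the class and an exponentially stable analytic semigroup `S t = e^{-tA}` on it
    (E : StochConv.BanachSp 𝕜) (hE : E ∈ D.cls) (S : StochConv.C0Semigroup 𝕜 E)
    (hS : S.IsAnalytic)
    (hstable : ∃ C₀ ω₀ : ℝ, ω₀ < 0 ∧ ∀ t : ℝ, 0 ≤ t → ‖S t‖ ≤ C₀ * Real.exp (t * ω₀))
    (θ : ℝ) (hθ : θ ∈ Set.Ioo 0 (1 - 1 / p))
    (hsg : D.SemigroupInterpBound S θ q (hp.le.trans hpq))
    (hmomentq : D.MomentBoundQ E q) :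
    ∃ C : ℝ≥0, ∀ T : ℝ≥0, 0 < T →
      ∀ ξ : StochConv.Mloc (𝕜 := 𝕜) P 𝓕 p hp (X := D.R E),
        -- the estimate for `∫₀ᵀ 𝔼 |SC_t(ξ)|^q dt`
        (∫⁻ t in Set.Icc 0 T, ∫⁻ ω,
            StochConv.interpDomENorm S (θ + 1 / p) q (D.SC hE hS t ξ ω) ^ q ∂P
              ∂StochConv.timeMeasure ≤
          C * ∫⁻ ω, ∫⁻ s in Set.Icc 0 T,
            D.relENorm S θ q (hp.le.trans hpq) (ξ.1 s ω) ^ q ∂StochConv.timeMeasure ∂P) ∧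
        -- the estimate for `𝔼 ∫₀ᵀ |SC_t(ξ)|^q dt`, for every jointly measurable version `Y` of
        -- the process `t ↦ SC_t(ξ)`
        (∀ Y : ℝ≥0 → Ω → E, StronglyMeasurable (Function.uncurry Y) →
          (∀ t ∈ Set.Icc 0 T, Y t =ᵐ[P] D.SC hE hS t ξ) →
          ∫⁻ ω, ∫⁻ t in Set.Icc 0 T,
              StochConv.interpDomENorm S (θ + 1 / p) q (Y t ω) ^ q ∂StochConv.timeMeasure ∂P ≤
            C * ∫⁻ ω, ∫⁻ s in Set.Icc 0 T,
              D.relENorm S θ q (hp.le.trans hpq) (ξ.1 s ω) ^ q ∂StochConv.timeMeasure ∂P) := by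
  have hσ : 0 < θ + 1 / p := by
    have : 0 < 1 / p := by positivity
    linarith [hθ.1]
  obtain ⟨C₁, hC₁⟩ := StochConv.exists_interpDomENorm_rpow_le hS hstable hσ (hp.le.trans hpq)
  obtain ⟨C₂, hC₂⟩ := D.exists_lintegral_SC_le hE hS hstable hpq hθ.2 hsg hmomentq
  refine ⟨C₁ * C₂, fun T _ ξ => ⟨?_, fun Y hY hYS => ?_⟩⟩
  · rw [ENNReal.coe_mul, mul_assoc]
    refine le_trans ?_ (mul_le_mul_right (hC₂ T ξ) _)
    rw [← lintegral_const_mul' _ _ ENNReal.coe_ne_top]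
    refine lintegral_mono fun t => ?_
    rw [← lintegral_const_mul' _ _ ENNReal.coe_ne_top]
    exact lintegral_mono fun ω => hC₁ _
  · rw [ENNReal.coe_mul, mul_assoc]
    refine le_trans ?_ (mul_le_mul_right (hC₂ T ξ) _)
    set W : ℝ → ℝ≥0∞ := fun r => ENNReal.ofReal (r ^ ((1 - (θ + 1 / p)) * q - 1)) with hW
    have hYm : Measurable fun z : (Ω × ℝ≥0) × ℝ =>
        W z.2 * ‖S.opAExpPos z.2 (Y z.1.2 z.1.1)‖ₑ ^ q := by
      refine Measurable.mul (by fun_prop) (Measurable.pow_const ?_ _)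
      exact (isBoundedBilinearMap_apply.continuous.comp_stronglyMeasurable
        ((hS.stronglyMeasurable_opAExpPos.comp_measurable measurable_snd).prodMk
          (hY.comp_measurable (measurable_swap.comp measurable_fst)))).enorm
    calc _ ≤ ∫⁻ ω, ∫⁻ t in Set.Icc 0 T,
          C₁ * ∫⁻ r in Ioi 0, W r * ‖S.opAExpPos r (Y t ω)‖ₑ ^ q ∂volume ∂StochConv.timeMeasure ∂P :=
          lintegral_mono fun ω => lintegral_mono fun t => hC₁ _
      _ = C₁ * ∫⁻ ω, ∫⁻ t in Set.Icc 0 T,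
          ∫⁻ r in Ioi 0, W r * ‖S.opAExpPos r (Y t ω)‖ₑ ^ q ∂volume ∂StochConv.timeMeasure ∂P := by
          simp only [lintegral_const_mul' _ _ ENNReal.coe_ne_top]
      _ = C₁ * ∫⁻ t in Set.Icc 0 T, ∫⁻ ω,
          ∫⁻ r in Ioi 0, W r * ‖S.opAExpPos r (Y t ω)‖ₑ ^ q ∂volume ∂P ∂StochConv.timeMeasure := by
          congr 1
          exact lintegral_lintegral_swap hYm.lintegral_prod_right'.aemeasurable
      _ = _ := by
          congr 1
          refine setLIntegral_congr_fun measurableSet_Icc fun t ht => ?_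
          refine lintegral_congr_ae ?_
          filter_upwards [hYS t ht] with ω hω
          rw [hω]
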